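/- Let $\varkappa_1>\varkappa_2>\dots>0$ be a strictly decreasing summable sequence of positive numbers, let $m_1,m_2,\dots$ be arbitrary positive numbers, and put $\alpha_j:=\varkappa_j/m_j$. In the Hilbert space $H=\ell_2(\mathbb N)$ consider the diagonal operators $K=\operatorname{diag}\{\varkappa_1,\varkappa_2,\dots\}$ and $A=\operatorname{diag}\{\alpha_1,\alpha_2,\dots\}$ ($A$ is possibly unbounded), the operator $\Gamma$ with matrix entries $(\Gamma)_{k,l}=\dfrac{\varkappa_k\varkappa_l}{\varkappa_k+\varkappa_l}$, and the vector $\boldsymbol\varkappa:=(\varkappa_1,\varkappa_2,\dots)$. For $x,t\in\mathbb R$ set $$\varphi(x,t):=\bigl\|(A^2e^{xK-tK^3}+\Gamma)^{-1/2}\boldsymbol\varkappa\bigr\|^2 ,$$ and for $\nu>0$ let $$\Omega_\nu:=\Bigl\{(z,\zeta)\in\mathbb C^2 : |\operatorname{Im} z|<\frac{\nu}{2\varkappa_1},\ |\operatorname{Im}\zeta|<\frac{\nu}{2\varkappa_1^3}\Bigr\}.$$ Then $\varphi$ is well defined on $\mathbb R^2$ (the operators $(A^2e^{xK-tK^3}+\Gamma)^{-1/2}$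 exist and $\boldsymbol\varkappa$ lies in their domains), it is infinitely differentiable, and $v=\varphi$ is a solution on $\mathbb R^2$ of the nonlinear equation $$v_t-3(v_x)^2+v_{xxx}=0 .$$ Moreover, $\varphi$ admits a holomorphic continuation (also denoted by $\varphi$) to the cylindrical domain $\Omega_{\pi/2}$, and $$|\varphi(z,\zeta)|\le\frac{|\varphi(\operatorname{Re}z,\operatorname{Re}\zeta)|}{\cos\nu}\le\frac{2}{\cos\nu}\sum_{j\ge1}\varkappa_j$$ whenever $(z,\zeta)\in\Omega_\nu$ for some $\nu\in(0,\pi/2)$. -/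

import Mathlib

open scoped InnerProductSpace ContDiff

/-- The Hilbert space `ℓ₂(ℕ)` of square-summable complex sequences (indexed from `0`). -/
abbrev EllTwo : Type := lp (fun _ : ℕ => ℂ) 2

/-- The data of the problem: a positive, strictly decreasing, summable sequence
`ϰ₁ > ϰ₂ > …` (with `ϰ_{n+1} = kappa n`) and an arbitrary sequence of positive norming
constants `m₁, m₂, …` (with `m_{n+1} = norming n`). -/
structure ScatteringData where
  kappa : ℕ → ℝ
  norming : ℕ → ℝ
  kappa_pos : ∀ n, 0 < kappa n
  kappa_strictAnti : StrictAnti kappa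
  kappa_summable : Summable kappa
  norming_pos : ∀ n, 0 < norming n

/-- The maximal operator in `ℓ₂(ℕ)` given by an infinite matrix `M`:
`(M f)_k = ∑_l M_{kl} f_l`, defined for those `f` for which all these series converge
and form a square-summable sequence.  For a diagonal matrix this is the usual diagonal
operator on its natural domain (self-adjoint when the entries are real, bounded or not). -/
noncomputable def matrixOp (M : Matrix ℕ ℕ ℂ) : EllTwo →ₗ.[ℂ] EllTwo where
  domain :=
    { carrier := {f | (∀ k, Summable fun l => M k l * f l) ∧
        Memℓp (fun k => ∑' l, M k l * f l) 2}
      zero_mem' := by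
        refine ⟨fun k => by simp, ?_⟩
        convert (zero_memℓp : Memℓp (0 : ∀ _ : ℕ, ℂ) 2) using 1
        funext k
        simp
      add_mem' := by
        rintro f g ⟨hf, hf'⟩ ⟨hg, hg'⟩
        refine ⟨fun k => by simpa [mul_add] using (hf k).add (hg k), ?_⟩
        convert hf'.add hg' using 1
        funext k
        simp [mul_add, (hf k).tsum_add (hg k)]
      smul_mem' := by
        rintro c f ⟨hf, hf'⟩
        refine ⟨fun k => by simpa [mul_left_comm] using (hf k).mul_left c, ?_⟩
        convert hf'.const_smul c using 1
        funext k
        simp [mul_left_comm, tsum_mul_left] }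
  toFun :=
    { toFun := fun f => ⟨fun k => ∑' l, M k l * f.1 l, f.2.2⟩
      map_add' := by
        rintro ⟨f, hf, hf'⟩ ⟨g, hg, hg'⟩
        ext k
        change ∑' l, M k l * (f l + g l) = ∑' l, M k l * f l + ∑' l, M k l * g l
        simpa only [mul_add] using (hf k).tsum_add (hg k)
      map_smul' := by
        rintro c ⟨f, hf, hf'⟩
        ext k
        simp [mul_left_comm, tsum_mul_left] }

/-- `S` is the inverse square root `T^{-1/2}` of the (possibly unbounded) operator `T`:
`S` is densely defined, self-adjoint and nonnegative, and `S² = T⁻¹` as unbounded operators,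
i.e. `T u = v` iff `v ∈ dom S`, `S v ∈ dom S` and `S (S v) = u`.
(For an injective nonnegative self-adjoint `T` there is exactly one such `S`.) -/
structure IsInvSqrt (T S : EllTwo →ₗ.[ℂ] EllTwo) : Prop where
  dense : Dense (S.domain : Set EllTwo)
  selfAdjoint : IsSelfAdjoint S
  nonneg : ∀ v : S.domain, 0 ≤ (⟪S v, (v : EllTwo)⟫_ℂ).re
  sq_eq_inv : ∀ u v : EllTwo,
    (u, v) ∈ T.graph ↔ ∃ w : EllTwo, (v, w) ∈ S.graph ∧ (w, u) ∈ S.graph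

open Classical in
/-- The operator `T^{-1/2}` (the zero operator on the zero subspace if there is none). -/
noncomputable def invSqrt (T : EllTwo →ₗ.[ℂ] EllTwo) : EllTwo →ₗ.[ℂ] EllTwo :=
  if h : ∃ S, IsInvSqrt T S then h.choose else ⊥

namespace ScatteringData

variable (d : ScatteringData)

/-- `α_n = ϰ_n / m_n`, the diagonal entries of `A`. -/
noncomputable def alpha (n : ℕ) : ℝ := d.kappa n / d.norming n

theorem memlp_kappa : Memℓp (fun n => (d.kappa n : ℂ)) 2 := by
  have h1 : Memℓp (fun n => (d.kappa n : ℂ)) 1 := by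
    refine memℓp_gen ?_
    simpa [abs_of_pos (d.kappa_pos _)] using d.kappa_summable
  exact h1.of_exponent_ge (by norm_num)

/-- The vector `ϰ = (ϰ₁, ϰ₂, …)` of `ℓ₂(ℕ)`. -/
noncomputable def kappaVec : EllTwo := ⟨fun n => (d.kappa n : ℂ), d.memlp_kappa⟩

/-- The operator `Γ` with matrix entries `ϰ_k ϰ_l / (ϰ_k + ϰ_l)`. -/
noncomputable def Gam : EllTwo →ₗ.[ℂ] EllTwo :=
  matrixOp (Matrix.of fun k l =>
    ((d.kappa k * d.kappa l / (d.kappa k + d.kappa l) : ℝ) : ℂ))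

/-- The operator `A² e^{xK - tK³}` for `K = diag{ϰ_n}`, `A = diag{α_n}`: the diagonal operator
with entries `α_n² e^{x ϰ_n - t ϰ_n³}` on its natural domain. -/
noncomputable def diagPart (x t : ℝ) : EllTwo →ₗ.[ℂ] EllTwo :=
  matrixOp (Matrix.diagonal fun n =>
    ((d.alpha n ^ 2 * Real.exp (x * d.kappa n - t * d.kappa n ^ 3) : ℝ) : ℂ))

/-- The operator `A² e^{xK - tK³} + Γ`, on the intersection of the domains. -/
noncomputable def opT (x t : ℝ) : EllTwo →ₗ.[ℂ] EllTwo := d.diagPart x t + d.Gam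

open Classical in
/-- `φ(x,t) = ‖(A² e^{xK - tK³} + Γ)^{-1/2} ϰ‖²`
(with the value `0` if `ϰ` were outside the domain). -/
noncomputable def phi (x t : ℝ) : ℝ :=
  if h : d.kappaVec ∈ (invSqrt (d.opT x t)).domain then
    ‖invSqrt (d.opT x t) ⟨d.kappaVec, h⟩‖ ^ 2
  else 0

/-- The cylinder `Ω_ν = {(z, ζ) : |Im z| < ν / (2 ϰ₁), |Im ζ| < ν / (2 ϰ₁³)}`. -/
def cyl (ν : ℝ) : Set (ℂ × ℂ) :=
  {p | |p.1.im| < ν / (2 * d.kappa 0) ∧ |p.2.im| < ν / (2 * d.kappa 0 ^ 3)}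

end ScatteringData

/-! Write `T = D + Γ` with `D = A² e^{xK - tK³}`. Everything rests on two properties of the kernel
`ϰ_k ϰ_l / (ϰ_k + ϰ_l)`. Analytically, it is nonnegative and satisfies `|∑ ϰ_n c_n|² ≤ 2 (∑ ϰ_n) ⟨c,
Γ c⟩` (`cauchyForm_nonneg_and_bound`). Thus `ϰ` is a bounded functional in the energy norm `⟨f, T
f⟩`, and `φ` is the squared norm of its Riesz vector `y = T^{-1/2} ϰ`; this bounds `φ` by `2 ∑ ϰ_n`.
Algebraically, multiplication by `ϰ_k + ϰ_l` turns the kernel into the rank one matrix `ϰ ϰᵀ`.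

The equation is proved for the finite sections `ϰᵀ T_N⁻¹ ϰ`. The rank one identity expresses
derivatives of the moments `ϰᵀ K^i T_N⁻¹ K^j ϰ` as polynomials in moments, and the equation reduces
to one relation, `mom_zero_three_sub`, read off from the commutator of `T_N` with `K²`.

For complex arguments in `Ω_ν` the diagonal entries have argument at most `ν` in absolute value, so
the real part of the form dominates `cos ν` times the form at the real parts. Hence the sections are
invertible and bounded by `φ(Re z, Re ζ) / cos ν`, uniformly in `N` (`norm_mom_le`).

The sections are Galerkin approximations (`tendsto_galerkin`). In the energy space at the origin
they converge to `⟨y, B(z,ζ)⁻¹ y⟩` with `B` analytic and coercive, which gives the continuation; in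
the energy space at a real point they converge to `φ` there. Local bounds and Cauchy's formula carry
the equation to the limit.

The unbounded `T^{-1/2}` is handled through the resolvent `R = (1 + T)⁻¹`: with `P = √R` and `Q =
√(1 - R)` it is `P Q⁻¹`, and `IsSinCos.eq_quotient` shows that there is no other inverse square
root. -/

open ComplexConjugate Filter Topology

/-! ### Positivity of the kernel `aᵢ aⱼ / (aᵢ + aⱼ)` -/

/-- The Hermitian form with the kernel `aᵢ aⱼ / (aᵢ + aⱼ)`. -/
noncomputable def cauchyForm {ι : Type*} (a : ι → ℝ) (s : Finset ι) (c : ι → ℂ) : ℂ :=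
  ∑ i ∈ s, ∑ j ∈ s, ((a i * a j / (a i + a j) : ℝ) : ℂ) * (conj (c i) * c j)

/-- The source is `(A + a)(A + b) - (A - a)(A - b) = 2A(a + b)`: twisting by the Blaschke factors
`(A - aᵢ)/(A + aᵢ)` changes the form by a rank one square. With `A` one of the `aᵢ`, the twist kills
that index, which drives the induction below. -/
theorem cauchyForm_eq_add {ι : Type*} (a : ι → ℝ) (ha : ∀ i, 0 < a i) (s : Finset ι) (c : ι → ℂ)
    {A : ℝ} (hA : 0 < A) :
    cauchyForm a s c = cauchyForm a s (fun i => ((A - a i) / (A + a i) : ℝ) * c i)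
      + ((2 * A * ‖∑ i ∈ s, ((a i / (A + a i) : ℝ) : ℂ) * c i‖ ^ 2 : ℝ) : ℂ) := by
  have h : ((2 * A * ‖∑ i ∈ s, ((a i / (A + a i) : ℝ) : ℂ) * c i‖ ^ 2 : ℝ) : ℂ) =
      ∑ i ∈ s, ∑ j ∈ s, ((2 * A * (a i / (A + a i)) * (a j / (A + a j)) : ℝ) : ℂ)
        * (conj (c i) * c j) := by
    push_cast
    rw [← Complex.conj_mul', map_sum, Finset.sum_mul_sum, Finset.mul_sum]
    refine Finset.sum_congr rfl fun i _ => ?_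
    rw [Finset.mul_sum]
    refine Finset.sum_congr rfl fun j _ => ?_
    simp only [map_mul, map_div₀, map_add, Complex.conj_ofReal]
    ring
  rw [h, cauchyForm, cauchyForm, ← Finset.sum_add_distrib]
  refine Finset.sum_congr rfl fun i _ => ?_
  rw [← Finset.sum_add_distrib]
  refine Finset.sum_congr rfl fun j _ => ?_
  have hi := ha i
  have hj := ha j
  have e : a i * a j / (a i + a j) = a i * a j / (a i + a j) * ((A - a i) / (A + a i)) *
      ((A - a j) / (A + a j)) + 2 * A * (a i / (A + a i)) * (a j / (A + a j)) := by
    field_simp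
    ring
  simp only [map_mul, Complex.conj_ofReal]
  conv_lhs => rw [e]
  push_cast
  ring

/-- The kernel `aᵢ aⱼ / (aᵢ + aⱼ)` is nonnegative, and it dominates the rank one form `|∑ aᵢ cᵢ|²`
up to the factor `2 ∑ aᵢ`. -/
theorem cauchyForm_nonneg_and_bound {ι : Type*} (a : ι → ℝ) (ha : ∀ i, 0 < a i) (s : Finset ι)
    (c : ι → ℂ) : 0 ≤ (cauchyForm a s c).re ∧
      ‖∑ i ∈ s, (a i : ℂ) * c i‖ ^ 2 ≤ 2 * (∑ i ∈ s, a i) * (cauchyForm a s c).re := by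
  classical
  induction s using Finset.induction_on generalizing c with
  | empty => simp [cauchyForm]
  | insert b s hb ih =>
    set A := a b with hA
    have hA0 : 0 < A := ha b
    set c' : ι → ℂ := fun i => ((A - a i) / (A + a i) : ℝ) * c i with hc'
    have hb0 : c' b = 0 := by simp [hc', hA]
    set h : ℂ := ∑ i ∈ insert b s, ((a i / (A + a i) : ℝ) : ℂ) * c i with hh
    have h1 := cauchyForm_eq_add a ha (insert b s) c hA0
    have h2 : cauchyForm a (insert b s) c' = cauchyForm a s c' := by
      simp [cauchyForm, Finset.sum_insert hb, hb0]
    have h3 : ∑ i ∈ insert b s, (a i : ℂ) * c i =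
        - ∑ i ∈ s, (a i : ℂ) * c' i + 2 * A * h := by
      have : ∑ i ∈ s, (a i : ℂ) * c' i = ∑ i ∈ insert b s, (a i : ℂ) * c' i := by
        simp [Finset.sum_insert hb, hb0]
      rw [this, hh, Finset.mul_sum, ← Finset.sum_neg_distrib, ← Finset.sum_add_distrib]
      refine Finset.sum_congr rfl fun i _ => ?_
      have hi := ha i
      have e : a i = -(a i * ((A - a i) / (A + a i))) + 2 * A * (a i / (A + a i)) := by
        field_simp
        ring
      simp only [hc']
      conv_lhs => rw [e]
      push_cast
      ring
    obtain ⟨p0, p1⟩ := ih c'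
    have h4 : (cauchyForm a (insert b s) c).re = (cauchyForm a s c').re + 2 * A * ‖h‖ ^ 2 := by
      rw [h1, h2, Complex.add_re, Complex.ofReal_re]
    refine ⟨by rw [h4]; positivity, ?_⟩
    rw [h4, h3, Finset.sum_insert hb, ← hA]
    set F : ℂ := ∑ i ∈ s, (a i : ℂ) * c' i
    set q := (cauchyForm a s c').re
    set σ := ∑ i ∈ s, a i
    have hσ : 0 ≤ σ := Finset.sum_nonneg fun i _ => (ha i).le
    have h5 : ‖-F + 2 * A * h‖ ≤ ‖F‖ + 2 * A * ‖h‖ := by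
      refine (norm_add_le _ _).trans ?_
      simp [abs_of_pos hA0]
    have h6 : ‖-F + 2 * A * h‖ ^ 2 ≤ (‖F‖ + 2 * A * ‖h‖) ^ 2 := by gcongr
    refine h6.trans ?_
    have hF := norm_nonneg F
    have hn := norm_nonneg h
    -- AM–GM: `‖F‖² ≤ 2σq` by induction, so the cross term is absorbed exactly by the extra `A` in
    -- the new sum `A + σ`.
    have h7 : 2 * ‖F‖ * ‖h‖ ≤ q + 2 * σ * ‖h‖ ^ 2 := by
      refine abs_le_of_sq_le_sq' ?_ (by positivity) |>.2
      nlinarith [sq_nonneg (q - 2 * σ * ‖h‖ ^ 2), mul_le_mul_of_nonneg_left p1 (sq_nonneg ‖h‖)]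
    nlinarith

/-! ### Coordinates and bounded diagonal operators in `ℓ₂` -/

namespace EllTwo

theorem memlp_iff {g : ℕ → ℂ} : Memℓp g 2 ↔ Summable fun n => ‖g n‖ ^ 2 := by
  rw [memℓp_gen_iff (by norm_num)]
  simp

theorem hasSum_norm_sq (f : EllTwo) : HasSum (fun n => ‖f n‖ ^ 2) (‖f‖ ^ 2) := by
  have h := lp.hasSum_norm (p := 2) (by norm_num) f
  simpa using h

theorem norm_apply_le (f : EllTwo) (n : ℕ) : ‖f n‖ ≤ ‖f‖ :=
  lp.norm_apply_le_norm (by norm_num) f n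

theorem norm_sq_le_of_forall {f g : EllTwo} {C : ℝ}
    (h : ∀ n, ‖f n‖ ^ 2 ≤ C * ‖g n‖ ^ 2) : ‖f‖ ^ 2 ≤ C * ‖g‖ ^ 2 :=
  hasSum_le h (hasSum_norm_sq f) ((hasSum_norm_sq g).mul_left C)

/-- Coordinates are given by a bounded functional. -/
noncomputable def coord (n : ℕ) : EllTwo →L[ℂ] ℂ :=
  LinearMap.mkContinuous
    { toFun := fun f => f n
      map_add' := fun _ _ => rfl
      map_smul' := fun _ _ => rfl } 1 fun f => by
    rw [one_mul]
    exact norm_apply_le f n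

/-- The standard basis of `ℓ₂`. -/
noncomputable def basisVec (n : ℕ) : EllTwo := lp.single 2 n (1 : ℂ)

theorem basisVec_apply (n k : ℕ) : basisVec n k = if k = n then 1 else 0 := by
  simp [basisVec, lp.single_apply, Pi.single_apply]

theorem inner_basisVec_left (n : ℕ) (f : EllTwo) : ⟪basisVec n, f⟫_ℂ = f n := by
  rw [basisVec, lp.inner_single_left (𝕜 := ℂ)]
  simp

theorem hasSum_smul_basisVec (f : EllTwo) : HasSum (fun n => f n • basisVec n) f := by
  have h := lp.hasSum_single (p := 2) (by norm_num) f
  convert h using 2 with n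
  rw [basisVec, ← lp.single_smul]
  simp

theorem hasSum_inner (f g : EllTwo) : HasSum (fun n => conj (f n) * g n) ⟪f, g⟫_ℂ := by
  have h := lp.hasSum_inner (𝕜 := ℂ) f g
  simpa [mul_comm] using h

/-- The diagonal operator with bounded entries. -/
noncomputable def diagOp (a : ℕ → ℂ) (C : ℝ) (h : ∀ n, ‖a n‖ ≤ C) : EllTwo →L[ℂ] EllTwo :=
  have key : ∀ (f : EllTwo) n, ‖a n * f n‖ ^ 2 ≤ C ^ 2 * ‖f n‖ ^ 2 := fun f n => by
    rw [norm_mul, mul_pow]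
    gcongr
    exact h n
  LinearMap.mkContinuous
    { toFun := fun f => ⟨fun n => a n * f n, memlp_iff.2 <| Summable.of_nonneg_of_le
        (fun n => sq_nonneg _) (key f) ((hasSum_norm_sq f).summable.mul_left _)⟩
      map_add' := fun f g => by
        ext n
        exact mul_add _ _ _
      map_smul' := fun c f => by
        ext n
        exact mul_left_comm _ _ _ } C fun f => by
    have hC : 0 ≤ C := (norm_nonneg _).trans (h 0)
    refine abs_le_of_sq_le_sq ?_ (by positivity) |> le_of_abs_le
    rw [mul_pow]
    exact norm_sq_le_of_forall (key f)

@[simp] theorem diagOp_apply (a : ℕ → ℂ) (C : ℝ) (h : ∀ n, ‖a n‖ ≤ C) (f : EllTwo) (n : ℕ) :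
    diagOp a C h f n = a n * f n := rfl

end EllTwo

/-! ### The bounded operator `Γ` -/

namespace ScatteringData

variable (d : ScatteringData)

/-- The matrix entries of `Γ`. -/
noncomputable def gamEntry (k l : ℕ) : ℝ := d.kappa k * d.kappa l / (d.kappa k + d.kappa l)

theorem gamEntry_comm (k l : ℕ) : d.gamEntry k l = d.gamEntry l k := by
  rw [gamEntry, gamEntry, mul_comm, add_comm]

/-- Since `ϰ_k ϰ_l ≤ (ϰ_k + ϰ_l)²`. Summed over both indices, this makes `Γ` Hilbert–Schmidt with
norm at most `∑ ϰ_j`. -/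
theorem gamEntry_sq_le (k l : ℕ) : d.gamEntry k l ^ 2 ≤ d.kappa k * d.kappa l := by
  have hk := d.kappa_pos k
  have hl := d.kappa_pos l
  rw [gamEntry, div_pow, div_le_iff₀ (by positivity)]
  have : 0 < d.kappa k * d.kappa l := by positivity
  nlinarith [sq_nonneg (d.kappa k), sq_nonneg (d.kappa l), mul_pos this this,
    mul_nonneg this.le (sq_nonneg (d.kappa k)), mul_nonneg this.le (sq_nonneg (d.kappa l))]

theorem summable_gamEntry_sq (k : ℕ) : Summable fun l => ‖(d.gamEntry k l : ℂ)‖ ^ 2 := by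
  refine Summable.of_nonneg_of_le (fun _ => sq_nonneg _) (fun l => ?_)
    (d.kappa_summable.mul_left (d.kappa k))
  rw [Complex.norm_real, Real.norm_eq_abs, sq_abs]
  exact d.gamEntry_sq_le k l

/-- The rows of `Γ`. -/
noncomputable def gamRow (k : ℕ) : EllTwo :=
  ⟨fun l => (d.gamEntry k l : ℂ), EllTwo.memlp_iff.2 (d.summable_gamEntry_sq k)⟩

theorem gamRow_apply (k l : ℕ) : d.gamRow k l = (d.gamEntry k l : ℂ) := rfl

theorem hasSum_gamRow (k : ℕ) (f : EllTwo) :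
    HasSum (fun l => (d.gamEntry k l : ℂ) * f l) ⟪d.gamRow k, f⟫_ℂ := by
  simpa [gamRow_apply] using EllTwo.hasSum_inner (d.gamRow k) f

theorem norm_inner_gamRow_sq_le (k : ℕ) (f : EllTwo) :
    ‖⟪d.gamRow k, f⟫_ℂ‖ ^ 2 ≤ d.kappa k * ((∑' j, d.kappa j) * ‖f‖ ^ 2) := by
  have h1 : ‖d.gamRow k‖ ^ 2 ≤ d.kappa k * ∑' j, d.kappa j := by
    refine hasSum_le (fun l => ?_) (EllTwo.hasSum_norm_sq (d.gamRow k))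
      (d.kappa_summable.hasSum.mul_left (d.kappa k))
    rw [gamRow_apply, Complex.norm_real, Real.norm_eq_abs, sq_abs]
    exact d.gamEntry_sq_le k l
  calc ‖⟪d.gamRow k, f⟫_ℂ‖ ^ 2 ≤ (‖d.gamRow k‖ * ‖f‖) ^ 2 := by
        gcongr
        exact norm_inner_le_norm _ _
    _ = ‖d.gamRow k‖ ^ 2 * ‖f‖ ^ 2 := mul_pow _ _ _
    _ ≤ (d.kappa k * ∑' j, d.kappa j) * ‖f‖ ^ 2 := by gcongr
    _ = _ := by ring

theorem memlp_gam (f : EllTwo) : Memℓp (fun k => ⟪d.gamRow k, f⟫_ℂ) 2 :=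
  EllTwo.memlp_iff.2 <| Summable.of_nonneg_of_le (fun _ => sq_nonneg _)
    (fun k => d.norm_inner_gamRow_sq_le k f) (d.kappa_summable.mul_right _)

/-- `Γ` as a linear map. -/
noncomputable def gamLin : EllTwo →ₗ[ℂ] EllTwo where
  toFun f := ⟨fun k => ⟪d.gamRow k, f⟫_ℂ, d.memlp_gam f⟩
  map_add' f g := by
    ext k
    exact inner_add_right _ _ _
  map_smul' c f := by
    ext k
    exact inner_smul_right _ _ _

theorem norm_gamLin_le (f : EllTwo) : ‖d.gamLin f‖ ≤ (∑' j, d.kappa j) * ‖f‖ := by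
  have hC : 0 ≤ ∑' j, d.kappa j := tsum_nonneg fun j => (d.kappa_pos j).le
  have h : ‖d.gamLin f‖ ^ 2 ≤ (∑' j, d.kappa j) * ((∑' j, d.kappa j) * ‖f‖ ^ 2) :=
    hasSum_le (fun k => d.norm_inner_gamRow_sq_le k f) (EllTwo.hasSum_norm_sq (d.gamLin f))
      (d.kappa_summable.hasSum.mul_right ((∑' j, d.kappa j) * ‖f‖ ^ 2))
  refine le_of_abs_le (abs_le_of_sq_le_sq (h.trans (le_of_eq ?_)) (mul_nonneg hC (norm_nonneg f)))
  ring

/-- `Γ` as a bounded operator. -/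
noncomputable def gamOp : EllTwo →L[ℂ] EllTwo :=
  d.gamLin.mkContinuous (∑' j, d.kappa j) d.norm_gamLin_le

theorem gamOp_apply (f : EllTwo) (k : ℕ) : d.gamOp f k = ⟪d.gamRow k, f⟫_ℂ := rfl

theorem inner_basisVec_gamOp (k l : ℕ) :
    ⟪EllTwo.basisVec k, d.gamOp (EllTwo.basisVec l)⟫_ℂ = (d.gamEntry k l : ℂ) := by
  rw [EllTwo.inner_basisVec_left, gamOp_apply, ← inner_conj_symm, EllTwo.inner_basisVec_left,
    gamRow_apply, Complex.conj_ofReal]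

set_option maxHeartbeats 800000 in
theorem inner_sum_gamOp (s : Finset ℕ) (c : ℕ → ℂ) :
    ⟪∑ n ∈ s, c n • EllTwo.basisVec n, d.gamOp (∑ n ∈ s, c n • EllTwo.basisVec n)⟫_ℂ =
      cauchyForm d.kappa s c := by
  rw [map_sum, sum_inner, cauchyForm]
  refine Finset.sum_congr rfl fun i _ => ?_
  rw [inner_sum]
  refine Finset.sum_congr rfl fun j _ => ?_
  rw [map_smul, inner_smul_left, inner_smul_right, inner_basisVec_gamOp, gamEntry]
  ring

theorem re_inner_gamOp_nonneg (f : EllTwo) : 0 ≤ (⟪f, d.gamOp f⟫_ℂ).re := by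
  have h : Tendsto (fun s : Finset ℕ => ∑ n ∈ s, f n • EllTwo.basisVec n) atTop (𝓝 f) :=
    EllTwo.hasSum_smul_basisVec f
  have h2 : Continuous fun g : EllTwo => (⟪g, d.gamOp g⟫_ℂ).re := by fun_prop
  refine ge_of_tendsto' ((h2.tendsto f).comp h) fun s => ?_
  simp only [Function.comp_apply]
  rw [inner_sum_gamOp]
  exact (cauchyForm_nonneg_and_bound d.kappa d.kappa_pos s _).1

theorem inner_gamOp_comm (f g : EllTwo) : ⟪d.gamOp f, g⟫_ℂ = ⟪f, d.gamOp g⟫_ℂ := by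
  have h : ∀ k, ∀ g : EllTwo,
      ⟪d.gamOp (EllTwo.basisVec k), g⟫_ℂ = ⟪EllTwo.basisVec k, d.gamOp g⟫_ℂ := by
    intro k g
    rw [EllTwo.inner_basisVec_left, gamOp_apply]
    congr 1
    ext l
    rw [gamOp_apply, ← inner_conj_symm, EllTwo.inner_basisVec_left, gamRow_apply, gamRow_apply,
      Complex.conj_ofReal, gamEntry_comm]
  have hf := EllTwo.hasSum_smul_basisVec f
  have h1 := (hf.mapL d.gamOp).mapL (innerSL ℂ g)
  have h2 := hf.mapL (innerSL ℂ (d.gamOp g))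
  have e : ∀ n, innerSL ℂ g (d.gamOp (f n • EllTwo.basisVec n)) =
      innerSL ℂ (d.gamOp g) (f n • EllTwo.basisVec n) := by
    intro n
    simp only [map_smul, innerSL_apply_apply]
    rw [← inner_conj_symm, h, inner_conj_symm]
  simp_rw [e] at h1
  have h3 := h1.unique h2
  simp only [innerSL_apply_apply] at h3
  rw [← inner_conj_symm, h3, inner_conj_symm]

end ScatteringData

/-! ### Existence and uniqueness of the inverse square root -/

theorem ContinuousLinearMap.exists_sqrt_pair {H : Type*} [NormedAddCommGroup H]
    [InnerProductSpace ℂ H] [CompleteSpace H] {R : H →L[ℂ] H} (h0 : 0 ≤ R) (h1 : R ≤ 1) :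
    ∃ P Q : H →L[ℂ] H, 0 ≤ P ∧ 0 ≤ Q ∧ 0 ≤ P * Q ∧ Commute P Q ∧ P * P = R ∧ Q * Q = 1 - R := by
  have h1R : 0 ≤ 1 - R := sub_nonneg.2 h1
  have hc1 : Commute R (1 - R) := (Commute.one_right R).sub_right (Commute.refl R)
  have hc2 : Commute (CFC.sqrt R) (1 - R) := by
    rw [CFC.sqrt_eq_cfc]
    exact hc1.cfc_nnreal _
  have hc : Commute (CFC.sqrt R) (CFC.sqrt (1 - R)) := by
    rw [CFC.sqrt_eq_cfc (a := 1 - R)]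
    exact (hc2.symm.cfc_nnreal _).symm
  exact ⟨CFC.sqrt R, CFC.sqrt (1 - R), CFC.sqrt_nonneg R, CFC.sqrt_nonneg _,
    hc.mul_nonneg (CFC.sqrt_nonneg R) (CFC.sqrt_nonneg _), hc,
    CFC.sqrt_mul_sqrt_self R h0, CFC.sqrt_mul_sqrt_self (1 - R) h1R⟩

theorem ContinuousLinearMap.eq_of_mul_self_eq {H : Type*} [NormedAddCommGroup H]
    [InnerProductSpace ℂ H] [CompleteSpace H] {A B : H →L[ℂ] H} (hA : 0 ≤ A) (hB : 0 ≤ B)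
    (h : A * A = B * B) : A = B := by
  rw [← CFC.sqrt_unique h hA, CFC.sqrt_mul_self B hB]

/-- A bounded operator with `0 ≤ R ≤ 1` such that `R` and `1 - R` are injective. -/
structure IsStrictContraction (R : EllTwo →L[ℂ] EllTwo) : Prop where
  nonneg : 0 ≤ R
  le_one : R ≤ 1
  inj : ∀ f, R f = 0 → f = 0
  inj_sub : ∀ f, R f = f → f = 0

/-- Commuting nonnegative injective operators with `P² + Q² = 1`. -/
structure IsSinCos (P Q : EllTwo →L[ℂ] EllTwo) : Prop where
  symmP : ∀ f g, ⟪P f, g⟫_ℂ = ⟪f, P g⟫_ℂ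
  symmQ : ∀ f g, ⟪Q f, g⟫_ℂ = ⟪f, Q g⟫_ℂ
  nonneg : 0 ≤ P * Q
  comm : ∀ f, P (Q f) = Q (P f)
  sq_add_sq : ∀ f, P (P f) + Q (Q f) = f
  injP : ∀ f, P f = 0 → f = 0
  injQ : ∀ f, Q f = 0 → f = 0

theorem IsStrictContraction.exists_isSinCos {R : EllTwo →L[ℂ] EllTwo}
    (hR : IsStrictContraction R) :
    ∃ P Q, IsSinCos P Q ∧ (∀ f, P (P f) = R f) ∧ ∀ f, Q (Q f) = f - R f := by
  obtain ⟨P, Q, hP0, hQ0, hPQ, hc, hPP, hQQ⟩ :=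
    ContinuousLinearMap.exists_sqrt_pair hR.nonneg hR.le_one
  have aPP : ∀ f, P (P f) = R f := fun f => DFunLike.congr_fun hPP f
  have aQQ : ∀ f, Q (Q f) = f - R f := fun f => DFunLike.congr_fun hQQ f
  have sP : ∀ f g, ⟪P f, g⟫_ℂ = ⟪f, P g⟫_ℂ :=
    ((ContinuousLinearMap.nonneg_iff_isPositive P).1 hP0).isSymmetric
  have sQ : ∀ f g, ⟪Q f, g⟫_ℂ = ⟪f, Q g⟫_ℂ :=
    ((ContinuousLinearMap.nonneg_iff_isPositive Q).1 hQ0).isSymmetric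
  refine ⟨P, Q, ⟨sP, sQ, ?_, fun f => DFunLike.congr_fun hc.eq f, ?_, ?_, ?_⟩, aPP, aQQ⟩
  · exact hPQ
  · intro f
    rw [aPP, aQQ]
    abel
  · intro f hf
    refine hR.inj f ?_
    rw [← aPP, hf, map_zero]
  · intro f hf
    refine hR.inj_sub f ?_
    have := aQQ f
    rw [hf, map_zero] at this
    exact (sub_eq_zero.1 this.symm).symm

namespace LinearPMap

theorem inner_comm_of_isSelfAdjoint {S : EllTwo →ₗ.[ℂ] EllTwo} (hd : Dense (S.domain : Set EllTwo))
    (hS : IsSelfAdjoint S) {v w v' w' : EllTwo} (h : (v, w) ∈ S.graph) (h' : (v', w') ∈ S.graph) :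
    ⟪w, v'⟫_ℂ = ⟪v, w'⟫_ℂ := by
  have e := adjoint_graph_eq_graph_adjoint hd
  rw [isSelfAdjoint_def.1 hS] at e
  rw [e, Submodule.mem_adjoint_iff] at h'
  exact sub_eq_zero.1 (h' v w h)

theorem mem_graph_of_isSelfAdjoint {S : EllTwo →ₗ.[ℂ] EllTwo} (hd : Dense (S.domain : Set EllTwo))
    (hS : IsSelfAdjoint S) {v w : EllTwo}
    (h : ∀ v' w', (v', w') ∈ S.graph → ⟪w', v⟫_ℂ = ⟪v', w⟫_ℂ) : (v, w) ∈ S.graph := by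
  have e := adjoint_graph_eq_graph_adjoint hd
  rw [isSelfAdjoint_def.1 hS] at e
  rw [e, Submodule.mem_adjoint_iff]
  exact fun a b hab => sub_eq_zero.2 (h a b hab)

theorem unique_of_mem_graph {S : EllTwo →ₗ.[ℂ] EllTwo} {v w w' : EllTwo} (h : (v, w) ∈ S.graph)
    (h' : (v, w') ∈ S.graph) : w = w' :=
  S.mem_graph_snd_inj h h' rfl

end LinearPMap

namespace IsSinCos

variable {P Q : EllTwo →L[ℂ] EllTwo}

/-- As `P² + Q² = 1`, the only candidate is `x = Q a + P b`. The graph of `P Q⁻¹` thereby becomes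
the solution set of a bounded equation. -/
theorem exists_iff (h : IsSinCos P Q) (a b : EllTwo) :
    (∃ x, Q x = a ∧ P x = b) ↔ P a = Q b := by
  constructor
  · rintro ⟨x, rfl, rfl⟩
    exact h.comm x
  · intro e
    refine ⟨Q a + P b, ?_, ?_⟩
    · rw [map_add, ← h.comm b, ← e, add_comm]
      exact h.sq_add_sq a
    · rw [map_add, h.comm a, e]
      rw [add_comm]
      exact h.sq_add_sq b

/-- The graph of `P Q⁻¹`. -/
noncomputable def graph (P Q : EllTwo →L[ℂ] EllTwo) : Submodule ℂ (EllTwo × EllTwo) :=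
  LinearMap.range ((Q : EllTwo →ₗ[ℂ] EllTwo).prod (P : EllTwo →ₗ[ℂ] EllTwo))

/-- The unbounded operator `P Q⁻¹`. -/
noncomputable def quotient (P Q : EllTwo →L[ℂ] EllTwo) : EllTwo →ₗ.[ℂ] EllTwo :=
  (graph P Q).toLinearPMap

theorem mem_quotient_graph (h : IsSinCos P Q) (a b : EllTwo) :
    (a, b) ∈ (quotient P Q).graph ↔ ∃ x, Q x = a ∧ P x = b := by
  rw [quotient, Submodule.toLinearPMap_graph_eq]
  · simp [graph]
  · rintro ⟨_, _⟩ ⟨x, hx⟩ h0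
    simp only [LinearMap.prod_apply] at hx
    obtain ⟨rfl, rfl⟩ := hx
    have : x = 0 := h.injQ x h0
    simp [this]

theorem dense_range (h : IsSinCos P Q) : Dense (Set.range Q) := by
  have : (LinearMap.range (Q : EllTwo →ₗ[ℂ] EllTwo)).topologicalClosure = ⊤ := by
    rw [Submodule.topologicalClosure_eq_top_iff, Submodule.eq_bot_iff]
    intro y hy
    refine h.injQ y ?_
    rw [Submodule.mem_orthogonal] at hy
    have := hy (Q (Q y)) ⟨Q y, rfl⟩
    rw [h.symmQ] at this
    exact inner_self_eq_zero.1 this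
  rw [← Submodule.dense_iff_topologicalClosure_eq_top] at this
  exact this

theorem dense_quotient_domain (h : IsSinCos P Q) :
    Dense ((quotient P Q).domain : Set EllTwo) := by
  refine h.dense_range.mono ?_
  rintro _ ⟨x, rfl⟩
  exact LinearPMap.mem_domain_of_mem_graph ((h.mem_quotient_graph (Q x) (P x)).2 ⟨x, rfl, rfl⟩)

/-- The pairs `(a, b)` in the adjoint graph are those with `P a = Q b`, which is again the graph of
`P Q⁻¹` by `exists_iff`. -/
theorem isSelfAdjoint_quotient (h : IsSinCos P Q) : IsSelfAdjoint (quotient P Q) := by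
  rw [LinearPMap.isSelfAdjoint_def]
  refine LinearPMap.eq_of_eq_graph ?_
  rw [LinearPMap.adjoint_graph_eq_graph_adjoint h.dense_quotient_domain]
  ext ⟨a, b⟩
  rw [Submodule.mem_adjoint_iff, h.mem_quotient_graph, h.exists_iff]
  have e : ∀ x, ⟪P x, a⟫_ℂ - ⟪Q x, b⟫_ℂ = ⟪x, P a - Q b⟫_ℂ := fun x => by
    rw [h.symmP, h.symmQ, inner_sub_right]
  constructor
  · intro hab
    have := hab (Q (P a - Q b)) (P (P a - Q b)) ((h.mem_quotient_graph _ _).2 ⟨_, rfl, rfl⟩)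
    simp only [e] at this
    exact sub_eq_zero.1 (inner_self_eq_zero.1 this)
  · intro hab a' b' hm
    obtain ⟨x, rfl, rfl⟩ := (h.mem_quotient_graph _ _).1 hm
    simp only [e, hab, sub_self, inner_zero_right]

theorem isInvSqrt_quotient (h : IsSinCos P Q) {T : EllTwo →ₗ.[ℂ] EllTwo}
    (hT : ∀ u v, (u, v) ∈ T.graph ↔ ∃ f, u = P (P f) ∧ v = Q (Q f)) :
    IsInvSqrt T (quotient P Q) where
  dense := h.dense_quotient_domain
  selfAdjoint := h.isSelfAdjoint_quotient
  nonneg v := by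
    obtain ⟨x, hx, hx'⟩ := (h.mem_quotient_graph _ _).1 ((quotient P Q).mem_graph v)
    rw [← hx, ← hx', ← h.symmQ]
    rw [← h.comm, h.symmP, h.symmQ]
    have := ((ContinuousLinearMap.nonneg_iff_isPositive _).1 h.nonneg).re_inner_nonneg_right x
    simpa [h.comm] using this
  sq_eq_inv u v := by
    rw [hT]
    simp only [h.mem_quotient_graph]
    constructor
    · rintro ⟨f, rfl, rfl⟩
      exact ⟨P (Q f), ⟨Q f, rfl, rfl⟩, ⟨P f, (h.comm f).symm, rfl⟩⟩
    · rintro ⟨w, ⟨x, rfl, rfl⟩, ⟨y, hy, rfl⟩⟩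
      obtain ⟨k, rfl, rfl⟩ := (h.exists_iff x y).2 hy.symm
      exact ⟨k, rfl, rfl⟩

/-- Let `c f` be the intermediate vector of `Q²f ↦ c f ↦ P²f` under `S`. It is everywhere defined
and symmetric, hence bounded by Hellinger–Toeplitz; it is nonnegative with square `Q²P²`, so it
equals `P Q`. Hence `S` agrees with `P Q⁻¹` on the range of `Q²`; symmetry and density extend this
to the range of `Q`, and nested self-adjoint operators coincide. -/
theorem eq_quotient (h : IsSinCos P Q) {T S : EllTwo →ₗ.[ℂ] EllTwo}
    (hT : ∀ u v, (u, v) ∈ T.graph ↔ ∃ f, u = P (P f) ∧ v = Q (Q f)) (hS : IsInvSqrt T S) :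
    S = quotient P Q := by
  have symm : ∀ {v w v' w' : EllTwo}, (v, w) ∈ S.graph → (v', w') ∈ S.graph →
      ⟪w, v'⟫_ℂ = ⟪v, w'⟫_ℂ :=
    fun h1 h2 => LinearPMap.inner_comm_of_isSelfAdjoint hS.dense hS.selfAdjoint h1 h2
  have pos : ∀ {v w : EllTwo}, (v, w) ∈ S.graph → 0 ≤ (⟪w, v⟫_ℂ).re := by
    intro v w hvw
    obtain ⟨y, rfl, rfl⟩ := (LinearPMap.mem_graph_iff S).1 hvw
    exact hS.nonneg y
  have ex : ∀ f, ∃ w, (Q (Q f), w) ∈ S.graph ∧ (w, P (P f)) ∈ S.graph := fun f =>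
    (hS.sq_eq_inv _ _).1 ((hT _ _).2 ⟨f, rfl, rfl⟩)
  choose c hc1 hc2 using ex
  have hcs : ∀ f g, ⟪c f, g⟫_ℂ = ⟪f, c g⟫_ℂ := by
    intro f g
    conv_lhs => rw [← h.sq_add_sq g]
    conv_rhs => rw [← h.sq_add_sq f]
    rw [inner_add_right, inner_add_left, symm (hc1 f) (hc1 g), ← symm (hc2 f) (hc2 g)]
  have hcadd : ∀ f g, c (f + g) = c f + c g := fun f g => by
    refine LinearPMap.unique_of_mem_graph (hc1 (f + g)) ?_
    have := S.graph.add_mem (hc1 f) (hc1 g)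
    simpa using this
  have hcsmul : ∀ (a : ℂ) f, c (a • f) = a • c f := fun a f => by
    refine LinearPMap.unique_of_mem_graph (hc1 (a • f)) ?_
    have := S.graph.smul_mem a (hc1 f)
    simpa using this
  let L : EllTwo →ₗ[ℂ] EllTwo := { toFun := c, map_add' := hcadd, map_smul' := hcsmul }
  let C : EllTwo →L[ℂ] EllTwo := ⟨L, LinearMap.IsSymmetric.continuous (T := L) hcs⟩
  have hC : ∀ f, C f = c f := fun f => rfl
  have hCpos : 0 ≤ C := by
    rw [ContinuousLinearMap.nonneg_iff_isPositive]
    refine ⟨hcs, fun f => ?_⟩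
    have e : ⟪C f, f⟫_ℂ = ⟪c f, Q (Q f)⟫_ℂ + ⟪P (P f), c f⟫_ℂ := by
      rw [symm (hc2 f) (hc2 f), hC, add_comm, ← inner_add_right, h.sq_add_sq]
    rw [ContinuousLinearMap.reApplyInnerSelf_apply, e]
    exact add_nonneg (pos (hc1 f)) (pos (hc2 f))
  have inj : ∀ {y z}, (y, z) ∈ S.graph → (z, -y) ∈ S.graph → y = 0 := by
    intro y z h1 h2
    have := symm h1 h2
    rw [inner_neg_right] at this
    have e := congrArg Complex.re this
    rw [Complex.neg_re] at e
    have h3 : 0 ≤ (⟪z, z⟫_ℂ).re := inner_self_nonneg (𝕜 := ℂ)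
    have h4 : 0 ≤ (⟪y, y⟫_ℂ).re := inner_self_nonneg (𝕜 := ℂ)
    have h5 : (⟪y, y⟫_ℂ).re = 0 := by linarith
    have h6 : RCLike.re ⟪y, y⟫_ℂ = 0 := h5
    rw [inner_self_eq_norm_sq] at h6
    simpa using h6
  have hcc : ∀ f, c (c f) = Q (Q (P (P f))) := by
    intro f
    set w := c f
    set u := P (P f)
    have a1 : (P (P w), u - c w) ∈ S.graph := by
      have := S.graph.sub_mem (hc2 f) (hc1 w)
      rw [Prod.mk_sub_mk] at this
      rwa [show P (P w) = w - Q (Q w) by rw [eq_sub_iff_add_eq]; exact h.sq_add_sq w]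
    -- The vector `y = c w - Q²u` satisfies `S (S y) = -y`, which `inj` excludes unless `y = 0`.
    have b1 := S.graph.sub_mem (hc2 w) (hc1 u)
    have b2 := S.graph.sub_mem a1 (hc2 u)
    rw [Prod.mk_sub_mk] at b1 b2
    refine sub_eq_zero.1 (inj b1 ?_)
    convert b2 using 2
    rw [show Q (Q u) = u - P (P u) by rw [eq_sub_iff_add_eq, add_comm]; exact h.sq_add_sq u]
    abel
  have hCPQ : C = P * Q := by
    refine ContinuousLinearMap.eq_of_mul_self_eq hCpos h.nonneg ?_
    ext1 f
    change C (C f) = P (Q (P (Q f)))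
    rw [hC, hC, hcc, h.comm (P (Q f)), h.comm f, h.comm (P f)]
  have sub : ∀ x, (Q x, P x) ∈ S.graph := by
    intro x
    refine LinearPMap.mem_graph_of_isSelfAdjoint hS.dense hS.selfAdjoint fun v' w' h' => ?_
    have e : (fun x => ⟪w', Q x⟫_ℂ) = fun x => ⟪v', P x⟫_ℂ := by
      refine Continuous.ext_on h.dense_range (by fun_prop) (by fun_prop) ?_
      rintro _ ⟨g, rfl⟩
      have hg := hc1 g
      rw [← hC, hCPQ] at hg
      exact symm h' hg
    exact congrFun e x
  refine LinearPMap.eq_of_eq_graph (le_antisymm ?_ ?_)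
  · rintro ⟨v, w⟩ hvw
    refine LinearPMap.mem_graph_of_isSelfAdjoint h.dense_quotient_domain h.isSelfAdjoint_quotient
      fun v' w' h' => ?_
    obtain ⟨x, rfl, rfl⟩ := (h.mem_quotient_graph _ _).1 h'
    exact symm (sub x) hvw
  · rintro ⟨v, w⟩ hvw
    obtain ⟨x, rfl, rfl⟩ := (h.mem_quotient_graph _ _).1 hvw
    exact sub x

end IsSinCos

/-! ### The operator `A² e^{xK - tK³} + Γ` and its resolvent -/

namespace ScatteringData

variable (d : ScatteringData)

/-- The diagonal entries of `A² e^{xK - tK³}`. -/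
noncomputable def weight (x t : ℝ) (n : ℕ) : ℝ :=
  d.alpha n ^ 2 * Real.exp (x * d.kappa n - t * d.kappa n ^ 3)

theorem alpha_pos (n : ℕ) : 0 < d.alpha n := div_pos (d.kappa_pos n) (d.norming_pos n)

theorem weight_pos (x t : ℝ) (n : ℕ) : 0 < d.weight x t n := by
  have := d.alpha_pos n
  rw [weight]
  positivity

theorem hasSum_diagonal (a : ℕ → ℂ) (f : EllTwo) (k : ℕ) :
    HasSum (fun l => (Matrix.diagonal a : Matrix ℕ ℕ ℂ) k l * f l) (a k * f k) := by
  have h := hasSum_single (f := fun l => (Matrix.diagonal a : Matrix ℕ ℕ ℂ) k l * f l) k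
    fun l hl => by simp [Matrix.diagonal_apply_ne' _ hl]
  simpa using h

/-- No domain condition remains: `Γ` is everywhere defined, so the coordinate equations exhibit the
diagonal image of `u` as `v - Γ u`, which is square summable. -/
theorem mem_graph_opT_iff (x t : ℝ) (u v : EllTwo) : (u, v) ∈ (d.opT x t).graph ↔
    ∀ k, v k = (d.weight x t k : ℂ) * u k + d.gamOp u k := by
  have hdiag : ∀ (y : (d.diagPart x t).domain) k,
      d.diagPart x t y k = (d.weight x t k : ℂ) * (y : EllTwo) k := fun y k =>
    (hasSum_diagonal (fun n => (d.weight x t n : ℂ)) y k).tsum_eq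
  have hgam : ∀ (y : d.Gam.domain) k, d.Gam y k = d.gamOp y k := fun y k =>
    (d.hasSum_gamRow k y).tsum_eq
  constructor
  · intro h k
    obtain ⟨y, rfl, rfl⟩ := (LinearPMap.mem_graph_iff _).1 h
    rw [← hdiag ⟨y, y.2.1⟩, ← hgam ⟨y, y.2.2⟩]
    rfl
  · intro h
    have h1 : u ∈ (d.diagPart x t).domain := by
      refine ⟨fun k => (hasSum_diagonal (fun n => (d.weight x t n : ℂ)) u k).summable, ?_⟩
      have := (lp.memℓp (v - d.gamOp u))
      convert this using 1
      funext k
      refine (hasSum_diagonal (fun n => (d.weight x t n : ℂ)) u k).tsum_eq.trans ?_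
      rw [lp.coeFn_sub, Pi.sub_apply, h k]
      ring
    have h2 : u ∈ d.Gam.domain := by
      refine ⟨fun k => (d.hasSum_gamRow k u).summable, ?_⟩
      have := (lp.memℓp (d.gamOp u))
      convert this using 1
      funext k
      exact (d.hasSum_gamRow k u).tsum_eq
    refine (LinearPMap.mem_graph_iff _).2 ⟨⟨u, h1, h2⟩, rfl, ?_⟩
    ext k
    rw [h k, ← hdiag ⟨u, h1⟩, ← hgam ⟨u, h2⟩]
    rfl

variable {d} {x t : ℝ}

theorem weight_mul_norm_sq_le {u v : EllTwo} (h : (u, v) ∈ (d.opT x t).graph) (k : ℕ) :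
    d.weight x t k * ‖u k‖ ^ 2 ≤ (⟪u, v⟫_ℂ).re := by
  rw [mem_graph_opT_iff] at h
  have h1 := (EllTwo.hasSum_inner u v).sub (EllTwo.hasSum_inner u (d.gamOp u))
  have h2 := Complex.hasSum_re h1
  have e : ∀ n, (conj (u n) * v n - conj (u n) * d.gamOp u n).re =
      d.weight x t n * ‖u n‖ ^ 2 := by
    intro n
    have : conj (u n) * v n - conj (u n) * d.gamOp u n =
        ((d.weight x t n * ‖u n‖ ^ 2 : ℝ) : ℂ) := by
      push_cast
      rw [h n, ← Complex.conj_mul']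
      ring
    rw [this, Complex.ofReal_re]
  simp only [e] at h2
  have h3 := le_hasSum h2 k fun j _ => mul_nonneg (d.weight_pos x t j).le (sq_nonneg _)
  have h4 := d.re_inner_gamOp_nonneg u
  rw [Complex.sub_re] at h3
  linarith

theorem re_inner_opT_nonneg {u v : EllTwo} (h : (u, v) ∈ (d.opT x t).graph) :
    0 ≤ (⟪u, v⟫_ℂ).re :=
  (mul_nonneg (d.weight_pos x t 0).le (sq_nonneg _)).trans (weight_mul_norm_sq_le h 0)

theorem eq_zero_of_re_inner_opT_le {u v : EllTwo} (h : (u, v) ∈ (d.opT x t).graph)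
    (h0 : (⟪u, v⟫_ℂ).re ≤ 0) : u = 0 := by
  ext k
  have h1 := (weight_mul_norm_sq_le h k).trans h0
  have h2 := d.weight_pos x t k
  have h3 : ‖u k‖ ^ 2 ≤ 0 := by
    by_contra hc
    have := mul_pos h2 (not_le.1 hc)
    linarith
  have h4 : ‖u k‖ = 0 := by
    have := norm_nonneg (u k)
    nlinarith
  simpa using h4

theorem inner_opT_comm {u v u' v' : EllTwo} (h : (u, v) ∈ (d.opT x t).graph)
    (h' : (u', v') ∈ (d.opT x t).graph) : ⟪v, u'⟫_ℂ = ⟪u, v'⟫_ℂ := by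
  rw [mem_graph_opT_iff] at h h'
  have h1 := (EllTwo.hasSum_inner v u').sub (EllTwo.hasSum_inner (d.gamOp u) u')
  have h2 := (EllTwo.hasSum_inner u v').sub (EllTwo.hasSum_inner u (d.gamOp u'))
  have e : ∀ n, conj (v n) * u' n - conj (d.gamOp u n) * u' n =
      conj (u n) * v' n - conj (u n) * d.gamOp u' n := by
    intro n
    rw [h, h', map_add, map_mul, Complex.conj_ofReal]
    ring
  simp only [e] at h1
  have h3 := h1.unique h2
  rwa [d.inner_gamOp_comm, sub_left_inj] at h3

/-- A nonnegative operator does not have the eigenvalue `-1`. This gives uniqueness for the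
resolvent equation and totality of the vectors `(1 + T) e_n`. -/
theorem eq_zero_of_neg_mem_graph {g : EllTwo} (h : (g, -g) ∈ (d.opT x t).graph) : g = 0 := by
  refine eq_zero_of_re_inner_opT_le h ?_
  rw [inner_neg_right, Complex.neg_re, neg_nonpos]
  exact inner_self_nonneg (𝕜 := ℂ)

variable (d x t)

/-- With `c = (1 + D)^{-1/2}`, a bounded diagonal operator, `(1 + T)⁻¹ = c (1 + c Γ c)⁻¹ c`; the
middle factor is invertible because `c Γ c ≥ 0`. -/
theorem exists_resolvent : ∃ R : EllTwo →L[ℂ] EllTwo, ∀ f, (R f, f - R f) ∈ (d.opT x t).graph := by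
  have hw : ∀ n, 1 ≤ √(d.weight x t n + 1) := fun n => by
    rw [Real.one_le_sqrt]
    linarith [d.weight_pos x t n]
  have hb : ∀ n, ‖(((√(d.weight x t n + 1))⁻¹ : ℝ) : ℂ)‖ ≤ 1 := fun n => by
    rw [Complex.norm_real, Real.norm_of_nonneg (by positivity)]
    exact inv_le_one_of_one_le₀ (hw n)
  set c : EllTwo →L[ℂ] EllTwo := EllTwo.diagOp _ 1 hb with hc
  have hcsymm : ∀ f g, ⟪c f, g⟫_ℂ = ⟪f, c g⟫_ℂ := by
    intro f g
    have h1 := EllTwo.hasSum_inner (c f) g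
    have h2 := EllTwo.hasSum_inner f (c g)
    refine h1.unique ?_
    convert h2 using 2 with n
    simp only [hc, EllTwo.diagOp_apply, map_mul, Complex.conj_ofReal]
    ring
  have hX : IsUnit (1 + c * d.gamOp * c) := by
    refine ContinuousLinearMap.isUnit_of_forall_le_norm_inner_map _ (c := 1) one_pos fun f => ?_
    have h1 : ⟪(1 + c * d.gamOp * c) f, f⟫_ℂ = ⟪f, f⟫_ℂ + ⟪d.gamOp (c f), c f⟫_ℂ := by
      rw [← hcsymm]
      exact inner_add_left _ _ _
    rw [h1]
    refine le_trans ?_ (Complex.re_le_norm _)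
    have h2 := d.re_inner_gamOp_nonneg (c f)
    rw [← d.inner_gamOp_comm] at h2
    have h3 : (⟪f, f⟫_ℂ).re = ‖f‖ ^ 2 := inner_self_eq_norm_sq (𝕜 := ℂ) f
    rw [Complex.add_re, h3]
    simpa using h2
  obtain ⟨X, hX⟩ := hX
  refine ⟨c * (↑X⁻¹ : EllTwo →L[ℂ] EllTwo) * c, fun f => ?_⟩
  rw [mem_graph_opT_iff]
  intro k
  set w : EllTwo := (↑X⁻¹ : EllTwo →L[ℂ] EllTwo) (c f) with hwdef
  have e1 : w + c (d.gamOp (c w)) = c f := by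
    have : (X : EllTwo →L[ℂ] EllTwo) w = c f := by
      have := DFunLike.congr_fun X.mul_inv (c f)
      exact this
    rw [hX] at this
    exact this
  have e2 := congrArg (fun g : EllTwo => g k) e1
  change (f - c w) k = (d.weight x t k : ℂ) * (c w) k + d.gamOp (c w) k
  simp only [lp.coeFn_add, Pi.add_apply, hc, EllTwo.diagOp_apply] at e2
  rw [lp.coeFn_sub, Pi.sub_apply]
  set G := d.gamOp (c w) k with hG
  have hs : ((√(d.weight x t k + 1) : ℝ) : ℂ) * √(d.weight x t k + 1) = d.weight x t k + 1 := by
    rw [← Complex.ofReal_mul, Real.mul_self_sqrt (by linarith [d.weight_pos x t k])]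
    push_cast
    rfl
  have hs0 : ((√(d.weight x t k + 1) : ℝ) : ℂ) ≠ 0 := by
    have := hw k
    exact_mod_cast (by positivity : (√(d.weight x t k + 1)) ≠ 0)
  have e3 : (c w) k = ((√(d.weight x t k + 1) : ℝ) : ℂ)⁻¹ * w k := by
    simp [hc]
  push_cast at e2
  have e4 : w k = ((√(d.weight x t k + 1) : ℝ) : ℂ)⁻¹ * (f k - G) := by
    rw [mul_sub, ← e2]
    ring
  have e5 : ((d.weight x t k : ℂ) + 1) * (c w) k = f k - G := by
    rw [e3, e4, ← hs]
    field_simp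
  linear_combination -e5

end ScatteringData

/-! ### The energy space and the vector representing `ϰ` -/

theorem denseRange_linearCombination {E : Type*} [NormedAddCommGroup E] [InnerProductSpace ℂ E]
    [CompleteSpace E] {τ : ℕ → E} (hτ : ∀ y, (∀ n, ⟪τ n, y⟫_ℂ = 0) → y = 0) :
    DenseRange (Finsupp.linearCombination ℂ τ) := by
  have : (LinearMap.range (Finsupp.linearCombination ℂ τ)).topologicalClosure = ⊤ := by
    rw [Submodule.topologicalClosure_eq_top_iff, Submodule.eq_bot_iff]
    intro y hy
    refine hτ y fun n => ?_
    rw [Submodule.mem_orthogonal] at hy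
    exact hy (τ n) ⟨Finsupp.single n 1, by simp⟩
  rw [← Submodule.dense_iff_topologicalClosure_eq_top] at this
  exact this

/-- A functional prescribed on a total sequence of a Hilbert space is represented by a vector as
soon as it is bounded. -/
theorem exists_inner_eq_of_bound {E : Type*} [NormedAddCommGroup E] [InnerProductSpace ℂ E]
    [CompleteSpace E] {τ : ℕ → E} (hτ : ∀ y, (∀ n, ⟪τ n, y⟫_ℂ = 0) → y = 0) (a : ℕ → ℝ) {C : ℝ}
    (hC : 0 ≤ C) (h : ∀ (s : Finset ℕ) (c : ℕ → ℂ),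
      ‖∑ n ∈ s, (a n : ℂ) * c n‖ ≤ C * ‖∑ n ∈ s, c n • τ n‖) :
    ∃ y, (∀ n, ⟪τ n, y⟫_ℂ = a n) ∧ ‖y‖ ≤ C := by
  set e := Finsupp.linearCombination ℂ τ with he
  set f := Finsupp.linearCombination ℂ (fun n => (a n : ℂ)) with hf
  have hd : DenseRange e := denseRange_linearCombination hτ
  have hn : ∀ x, ‖f x‖ ≤ C * ‖e x‖ := fun x => by
    have := h x.support x
    simpa [he, hf, Finsupp.linearCombination_apply, Finsupp.sum, mul_comm] using this
  refine ⟨(InnerProductSpace.toDual ℂ E).symm (f.extendOfNorm e), fun n => ?_, ?_⟩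
  swap
  · rw [LinearIsometryEquiv.norm_map]
    exact LinearMap.opNorm_extendOfNorm_le hd hC hn
  rw [← inner_conj_symm, InnerProductSpace.toDual_symm_apply]
  have h1 : τ n = e (Finsupp.single n 1) := by simp [he]
  rw [h1, LinearMap.extendOfNorm_eq hd ⟨C, hn⟩]
  simp [hf]

namespace ScatteringData

variable (d : ScatteringData)

/-- A total sequence whose Gram matrix is `diag δ + Γ`. -/
structure IsEnergyFrame (δ : ℕ → ℝ) (τ : ℕ → EllTwo) : Prop where
  total : ∀ y, (∀ n, ⟪τ n, y⟫_ℂ = 0) → y = 0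
  gram : ∀ k l, ⟪τ k, τ l⟫_ℂ = ((if k = l then δ k else 0 : ℝ) : ℂ) + (d.gamEntry k l : ℂ)

variable {d}

theorem IsEnergyFrame.norm_sum_sq {δ : ℕ → ℝ} {τ : ℕ → EllTwo} (h : d.IsEnergyFrame δ τ)
    (s : Finset ℕ) (c : ℕ → ℂ) : ‖∑ n ∈ s, c n • τ n‖ ^ 2 =
      ∑ n ∈ s, δ n * ‖c n‖ ^ 2 + (cauchyForm d.kappa s c).re := by
  have h1 : ⟪∑ n ∈ s, c n • τ n, ∑ n ∈ s, c n • τ n⟫_ℂ =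
      ((∑ n ∈ s, δ n * ‖c n‖ ^ 2 : ℝ) : ℂ) + cauchyForm d.kappa s c := by
    rw [sum_inner, cauchyForm, Complex.ofReal_sum, ← Finset.sum_add_distrib]
    refine Finset.sum_congr rfl fun i hi => ?_
    have h2 : ((δ i * ‖c i‖ ^ 2 : ℝ) : ℂ) =
        ∑ j ∈ s, ((if i = j then δ i else 0 : ℝ) : ℂ) * (conj (c i) * c j) := by
      rw [Finset.sum_eq_single_of_mem i hi]
      · rw [if_pos rfl, Complex.conj_mul']
        push_cast
        rfl
      · intro j _ hj
        simp [Ne.symm hj]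
    rw [inner_sum, h2, ← Finset.sum_add_distrib]
    refine Finset.sum_congr rfl fun j _ => ?_
    rw [inner_smul_left, inner_smul_right, h.gram, gamEntry]
    ring
  have h2 : (⟪∑ n ∈ s, c n • τ n, ∑ n ∈ s, c n • τ n⟫_ℂ).re = ‖∑ n ∈ s, c n • τ n‖ ^ 2 :=
    inner_self_eq_norm_sq (𝕜 := ℂ) _
  rw [← h2, h1, Complex.add_re, Complex.ofReal_re]

/-- The kernel bound survives the addition of a positive diagonal. The constant is the one in the
final estimate. -/
theorem IsEnergyFrame.sum_kappa_sq_le {δ : ℕ → ℝ} {τ : ℕ → EllTwo} (h : d.IsEnergyFrame δ τ)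
    (hδ : ∀ n, 0 < δ n) (s : Finset ℕ) (c : ℕ → ℂ) :
    ‖∑ n ∈ s, (d.kappa n : ℂ) * c n‖ ^ 2 ≤ (2 * ∑' j, d.kappa j) * ‖∑ n ∈ s, c n • τ n‖ ^ 2 := by
  obtain ⟨h0, h1⟩ := cauchyForm_nonneg_and_bound d.kappa d.kappa_pos s c
  have h2 : ∑ n ∈ s, d.kappa n ≤ ∑' j, d.kappa j :=
    d.kappa_summable.sum_le_tsum s fun j _ => (d.kappa_pos j).le
  have h3 : 0 ≤ ∑ n ∈ s, δ n * ‖c n‖ ^ 2 :=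
    Finset.sum_nonneg fun n _ => mul_nonneg (hδ n).le (sq_nonneg _)
  have h4 : 0 ≤ ∑' j, d.kappa j := tsum_nonneg fun j => (d.kappa_pos j).le
  rw [h.norm_sum_sq]
  refine h1.trans ?_
  gcongr
  linarith

theorem IsEnergyFrame.exists_dual {δ : ℕ → ℝ} {τ : ℕ → EllTwo} (h : d.IsEnergyFrame δ τ)
    (hδ : ∀ n, 0 < δ n) :
    ∃ y, (∀ n, ⟪τ n, y⟫_ℂ = d.kappa n) ∧ ‖y‖ ^ 2 ≤ 2 * ∑' j, d.kappa j := by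
  have h4 : 0 ≤ 2 * ∑' j, d.kappa j :=
    mul_nonneg zero_le_two (tsum_nonneg fun j => (d.kappa_pos j).le)
  have hb : ∀ (s : Finset ℕ) (c : ℕ → ℂ), ‖∑ n ∈ s, (d.kappa n : ℂ) * c n‖ ≤
      √(2 * ∑' j, d.kappa j) * ‖∑ n ∈ s, c n • τ n‖ := by
    intro s c
    refine le_of_abs_le (abs_le_of_sq_le_sq ?_ (by positivity))
    rw [mul_pow, Real.sq_sqrt h4]
    exact h.sum_kappa_sq_le hδ s c
  obtain ⟨y, hy, hy'⟩ := exists_inner_eq_of_bound h.total d.kappa (Real.sqrt_nonneg _) hb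
  exact ⟨y, hy, (Real.le_sqrt (norm_nonneg y) h4).1 hy'⟩

variable (d)

/-- The value `φ(x,t)` is the square of the norm of the vector representing the functional
`f ↦ ⟪ϰ, f⟫` in the energy space of `A² e^{xK - tK³} + Γ`. -/
theorem exists_energyFrame (x t : ℝ) :
    (IsInvSqrt (d.opT x t) (invSqrt (d.opT x t)) ∧
      d.kappaVec ∈ (invSqrt (d.opT x t)).domain) ∧
    ∃ (τ : ℕ → EllTwo) (y : EllTwo), d.IsEnergyFrame (d.weight x t) τ ∧
      (∀ n, ⟪τ n, y⟫_ℂ = d.kappa n) ∧ d.phi x t = ‖y‖ ^ 2 ∧ ‖y‖ ^ 2 ≤ 2 * ∑' j, d.kappa j := by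
  obtain ⟨R, hR⟩ := d.exists_resolvent x t
  have huniq : ∀ {u v}, (u, v) ∈ (d.opT x t).graph → R (u + v) = u := by
    intro u v h
    have h1 := (d.opT x t).graph.sub_mem h (hR (u + v))
    rw [Prod.mk_sub_mk] at h1
    have h2 : u - R (u + v) = 0 := by
      refine eq_zero_of_neg_mem_graph (d := d) (x := x) (t := t) ?_
      convert h1 using 2
      abel
    exact (sub_eq_zero.1 h2).symm
  have hRsymm : ∀ f g, ⟪R f, g⟫_ℂ = ⟪f, R g⟫_ℂ := by
    intro f g
    have h1 := inner_opT_comm (hR f) (hR g)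
    rw [inner_sub_left, inner_sub_right, sub_left_inj] at h1
    exact h1.symm
  have hstrict : IsStrictContraction R := by
    refine ⟨?_, ?_, ?_, ?_⟩
    · rw [ContinuousLinearMap.nonneg_iff_isPositive]
      refine ⟨hRsymm, fun f => ?_⟩
      have h1 := re_inner_opT_nonneg (hR f)
      have h2 : 0 ≤ (⟪R f, R f⟫_ℂ).re := inner_self_nonneg (𝕜 := ℂ)
      rw [inner_sub_right, Complex.sub_re] at h1
      change 0 ≤ (⟪R f, f⟫_ℂ).re
      linarith
    · rw [ContinuousLinearMap.le_def]
      refine ⟨fun f g => ?_, fun f => ?_⟩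
      · change ⟪f - R f, g⟫_ℂ = ⟪f, g - R g⟫_ℂ
        rw [inner_sub_left, inner_sub_right, hRsymm]
      · have h1 := re_inner_opT_nonneg (hR f)
        have h2 : 0 ≤ (⟪f - R f, f - R f⟫_ℂ).re := inner_self_nonneg (𝕜 := ℂ)
        have h3 : ⟪f - R f, f⟫_ℂ = ⟪f - R f, f - R f⟫_ℂ + ⟪f - R f, R f⟫_ℂ := by
          rw [← inner_add_right, sub_add_cancel]
        have h4 : (⟪f - R f, R f⟫_ℂ).re = (⟪R f, f - R f⟫_ℂ).re := inner_re_symm (𝕜 := ℂ) _ _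
        change 0 ≤ (⟪f - R f, f⟫_ℂ).re
        rw [h3, Complex.add_re, h4]
        linarith
    · intro f hf
      have h1 := hR f
      rw [mem_graph_opT_iff, hf] at h1
      ext k
      simpa using h1 k
    · intro f hf
      have h1 := hR f
      rw [hf, sub_self] at h1
      exact eq_zero_of_re_inner_opT_le h1 (by simp)
  obtain ⟨P, Q, hPQ, hPP, hQQ⟩ := hstrict.exists_isSinCos
  have hT : ∀ u v, (u, v) ∈ (d.opT x t).graph ↔ ∃ f, u = P (P f) ∧ v = Q (Q f) := by
    intro u v
    constructor
    · intro h
      refine ⟨u + v, ?_, ?_⟩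
      · rw [hPP, huniq h]
      · rw [hQQ, huniq h, add_sub_cancel_left]
    · rintro ⟨f, rfl, rfl⟩
      rw [hPP, hQQ]
      exact hR f
  have hex : ∃ S, IsInvSqrt (d.opT x t) S := ⟨_, hPQ.isInvSqrt_quotient hT⟩
  have hinv : IsInvSqrt (d.opT x t) (invSqrt (d.opT x t)) := by
    rw [invSqrt, dif_pos hex]
    exact hex.choose_spec
  have hS := hPQ.eq_quotient hT hinv
  set Te : ℕ → EllTwo := fun n =>
    (d.weight x t n : ℂ) • EllTwo.basisVec n + d.gamOp (EllTwo.basisVec n) with hTe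
  have hgraph : ∀ n, (EllTwo.basisVec n, Te n) ∈ (d.opT x t).graph := by
    intro n
    rw [mem_graph_opT_iff]
    intro k
    simp only [hTe, lp.coeFn_add, lp.coeFn_smul, Pi.add_apply, Pi.smul_apply, smul_eq_mul,
      EllTwo.basisVec_apply]
    by_cases h : k = n
    · simp [h]
    · simp [h]
  set f : ℕ → EllTwo := fun n => EllTwo.basisVec n + Te n with hf
  have hRf : ∀ n, R (f n) = EllTwo.basisVec n := fun n => huniq (hgraph n)
  -- Orthogonality to every `(1 + T) e_n` says coordinatewise that `T g = -g`.
  have htotal : ∀ g, (∀ n, ⟪f n, g⟫_ℂ = 0) → g = 0 := by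
    intro g hg
    refine eq_zero_of_neg_mem_graph (d := d) (x := x) (t := t) ?_
    rw [mem_graph_opT_iff]
    intro k
    have h1 := hg k
    simp only [hf, hTe, inner_add_left, inner_smul_left, Complex.conj_ofReal,
      EllTwo.inner_basisVec_left, d.inner_gamOp_comm] at h1
    rw [lp.coeFn_neg, Pi.neg_apply]
    linear_combination -h1
  -- Formally `T^{1/2} = Q P⁻¹` and `1 + T = P⁻²`, so `Q P (1 + T) e_n` is `T^{1/2} e_n`, whose Gram
  -- matrix is that of `T`.
  have hframe : d.IsEnergyFrame (d.weight x t) fun n => Q (P (f n)) := by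
    refine ⟨fun y hy => ?_, fun k l => ?_⟩
    · refine hPQ.injQ y (hPQ.injP _ (htotal _ fun n => ?_))
      rw [← hPQ.symmP, ← hPQ.symmQ]
      exact hy n
    · rw [hPQ.symmQ, ← hPQ.comm (f l), ← hPQ.comm (Q (f l)), ← hPQ.symmP, hPP, hQQ, hRf, hRf]
      simp only [hf, hTe, add_sub_cancel_left, inner_add_right, inner_smul_right,
        d.inner_basisVec_gamOp, EllTwo.inner_basisVec_left, EllTwo.basisVec_apply]
      by_cases h : k = l
      · simp [h]
      · simp [h]
  obtain ⟨y, hy, hy'⟩ := hframe.exists_dual (d.weight_pos x t)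
  -- By `exists_iff` this equation says that `P Q⁻¹` maps `ϰ` to `y`; it is tested against the total
  -- vectors `P (f n)`.
  have hkey : P d.kappaVec = Q y := by
    refine sub_eq_zero.1 (hPQ.injP _ (htotal _ fun n => ?_))
    rw [map_sub, inner_sub_right, hPP, ← hRsymm, hRf, EllTwo.inner_basisVec_left, ← hPQ.symmP,
      ← hPQ.symmQ, hy n, sub_eq_zero]
    rfl
  have hmem : (d.kappaVec, y) ∈ (invSqrt (d.opT x t)).graph := by
    rw [hS, hPQ.mem_quotient_graph, hPQ.exists_iff]
    exact hkey
  have hdom := LinearPMap.mem_domain_of_mem_graph hmem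
  refine ⟨⟨hinv, hdom⟩, _, y, hframe, hy, ?_, hy'⟩
  have e : invSqrt (d.opT x t) ⟨d.kappaVec, hdom⟩ = y :=
    LinearPMap.unique_of_mem_graph ((invSqrt (d.opT x t)).mem_graph ⟨d.kappaVec, hdom⟩) hmem
  rw [phi, dif_pos hdom, e]

end ScatteringData

/-! ### Differentiating an inverse matrix -/

namespace Matrix

variable {n : Type*} [Fintype n] [DecidableEq n]

theorem tendsto_inv_mulVec {T : ℂ → Matrix n n ℂ} {s₀ : ℂ} (hT : ContinuousAt T s₀)
    (hdet : (T s₀).det ≠ 0) (v : n → ℂ) :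
    Tendsto (fun s => (T s)⁻¹ *ᵥ v) (𝓝 s₀) (𝓝 ((T s₀)⁻¹ *ᵥ v)) := by
  have h1 : Continuous fun A : Matrix n n ℂ => A.det := by fun_prop
  have h2 : Continuous fun A : Matrix n n ℂ => A.adjugate := by fun_prop
  have h3 : Tendsto (fun s => (T s)⁻¹) (𝓝 s₀) (𝓝 (T s₀)⁻¹) := by
    simp only [Matrix.inv_def, Ring.inverse_eq_inv']
    exact ((h1.tendsto _).comp hT |>.inv₀ hdet).smul ((h2.tendsto _).comp hT)
  have h4 : Continuous fun A : Matrix n n ℂ => A *ᵥ v := by fun_prop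
  exact (h4.tendsto _).comp h3

/-- The derivative of a matrix element of the inverse, when only the diagonal varies. -/
theorem hasDerivAt_dotProduct_inv {D : ℂ → n → ℂ} {D' : n → ℂ} {G : Matrix n n ℂ}
    {s₀ : ℂ} (hG : G.IsSymm) (hD : ∀ i, HasDerivAt (fun s => D s i) (D' i) s₀)
    (hdet : (diagonal (D s₀) + G).det ≠ 0) (v w : n → ℂ) :
    HasDerivAt (fun s => v ⬝ᵥ (diagonal (D s) + G)⁻¹ *ᵥ w)
      (-(((diagonal (D s₀) + G)⁻¹ *ᵥ v) ⬝ᵥ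
        diagonal D' *ᵥ ((diagonal (D s₀) + G)⁻¹ *ᵥ w))) s₀ := by
  set T : ℂ → Matrix n n ℂ := fun s => diagonal (D s) + G with hT
  have hTsymm : ∀ s, (T s).IsSymm := fun s => (isSymm_diagonal _).add hG
  have hTc : ContinuousAt T s₀ := by
    have h1 : ContinuousAt D s₀ := continuousAt_pi.2 fun i => (hD i).continuousAt
    have h2 : Continuous fun x : n → ℂ => diagonal x + G := by fun_prop
    exact h2.continuousAt.comp h1
  have hev : ∀ᶠ s in 𝓝 s₀, (T s).det ≠ 0 := by
    have h1 : Continuous fun A : Matrix n n ℂ => A.det := by fun_prop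
    exact ((h1.tendsto _).comp hTc).eventually_ne hdet
  rw [hasDerivAt_iff_tendsto_slope]
  -- The resolvent identity `T(s)⁻¹ - T(s₀)⁻¹ = -T(s)⁻¹ (T(s) - T(s₀)) T(s₀)⁻¹`, with `T(s)⁻¹` moved
  -- onto `v` by symmetry.
  have hslope : ∀ᶠ s in 𝓝[≠] s₀, -∑ i, ((T s)⁻¹ *ᵥ v) i *
      (slope (fun s => D s i) s₀ s * ((T s₀)⁻¹ *ᵥ w) i) =
        slope (fun s => v ⬝ᵥ (T s)⁻¹ *ᵥ w) s₀ s := by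
    filter_upwards [hev.filter_mono nhdsWithin_le_nhds, self_mem_nhdsWithin] with s hs hne
    have hne' : s - s₀ ≠ 0 := sub_ne_zero.2 hne
    have e1 : T s₀ *ᵥ ((T s₀)⁻¹ *ᵥ w) = w := by
      rw [mulVec_mulVec, mul_nonsing_inv _ (isUnit_iff_ne_zero.2 hdet), one_mulVec]
    have e2 : v ⬝ᵥ (T s)⁻¹ *ᵥ w = ((T s)⁻¹ *ᵥ v) ⬝ᵥ (T s₀ *ᵥ ((T s₀)⁻¹ *ᵥ w)) := by
      rw [e1, dotProduct_mulVec, ← mulVec_transpose, transpose_nonsing_inv, (hTsymm s).eq]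
    have e3 : v ⬝ᵥ (T s₀)⁻¹ *ᵥ w = ((T s)⁻¹ *ᵥ v) ⬝ᵥ (T s *ᵥ ((T s₀)⁻¹ *ᵥ w)) := by
      rw [dotProduct_mulVec _ (T s), ← mulVec_transpose, (hTsymm s).eq, mulVec_mulVec,
        mul_nonsing_inv _ (isUnit_iff_ne_zero.2 hs), one_mulVec]
    have e4 : T s - T s₀ = diagonal (fun i => D s i - D s₀ i) := by
      simp [hT]
    rw [slope_def_field, e2, e3, ← dotProduct_sub, ← sub_mulVec, ← neg_sub (T s), e4, neg_mulVec,
      dotProduct_neg, neg_div, dotProduct, Finset.sum_div]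
    congr 1
    refine Finset.sum_congr rfl fun i _ => ?_
    rw [mulVec_diagonal, slope_def_field]
    ring
  refine Tendsto.congr' hslope ?_
  simp only [dotProduct, mulVec_diagonal]
  refine (tendsto_finsetSum _ fun i _ => ?_).neg
  have h1 := (continuous_apply i).continuousAt.tendsto.comp (tendsto_inv_mulVec hTc hdet v)
  exact (h1.mono_left nhdsWithin_le_nhds).mul
    ((hasDerivAt_iff_tendsto_slope.1 (hD i)).mul tendsto_const_nhds)

end Matrix

/-! ### Moments of the finite sections and their derivatives -/

namespace ScatteringData

variable (d : ScatteringData)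

open Matrix

/-- The entries of the diagonal part at complex arguments. -/
noncomputable def cweight (z ζ : ℂ) (n : ℕ) : ℂ :=
  (d.alpha n : ℂ) ^ 2 * Complex.exp (z * d.kappa n - ζ * (d.kappa n : ℂ) ^ 3)

theorem cweight_ofReal (x t : ℝ) (n : ℕ) : d.cweight x t n = (d.weight x t n : ℂ) := by
  rw [cweight, weight]
  push_cast
  rfl

theorem hasDerivAt_cweight_fst (z ζ : ℂ) (n : ℕ) :
    HasDerivAt (fun s => d.cweight s ζ n) (d.kappa n * d.cweight z ζ n) z := by
  have h := (((hasDerivAt_id z).mul_const (d.kappa n : ℂ)).sub_const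
    (ζ * (d.kappa n : ℂ) ^ 3)).cexp.const_mul ((d.alpha n : ℂ) ^ 2)
  refine h.congr_deriv ?_
  simp only [cweight, id]
  ring

theorem hasDerivAt_cweight_snd (z ζ : ℂ) (n : ℕ) :
    HasDerivAt (fun s => d.cweight z s n) (-((d.kappa n : ℂ) ^ 3 * d.cweight z ζ n)) ζ := by
  have h := (((hasDerivAt_id ζ).mul_const ((d.kappa n : ℂ) ^ 3)).const_sub
    (z * d.kappa n)).cexp.const_mul ((d.alpha n : ℂ) ^ 2)
  refine h.congr_deriv ?_
  simp only [cweight, id]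
  ring

/-- The `N × N` section of `Γ`. -/
noncomputable def gamSection (N : ℕ) : Matrix (Fin N) (Fin N) ℂ :=
  Matrix.of fun k l => (d.gamEntry k l : ℂ)

theorem gamSection_isSymm (N : ℕ) : (d.gamSection N).IsSymm := by
  ext k l
  simp [gamSection, d.gamEntry_comm k l]

/-- The `N × N` section of `A² e^{zK - ζK³} + Γ`. -/
noncomputable def opSection (N : ℕ) (z ζ : ℂ) : Matrix (Fin N) (Fin N) ℂ :=
  Matrix.diagonal (fun n : Fin N => d.cweight z ζ n) + d.gamSection N

theorem opSection_isSymm (N : ℕ) (z ζ : ℂ) : (d.opSection N z ζ).IsSymm :=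
  (Matrix.isSymm_diagonal _).add (d.gamSection_isSymm N)

/-- The section of the vector `K^j ϰ`. -/
noncomputable def kappaPow (N j : ℕ) : Fin N → ℂ := fun n => (d.kappa n : ℂ) ^ (j + 1)

/-- The section of `K`. -/
noncomputable def kSection (N : ℕ) : Matrix (Fin N) (Fin N) ℂ :=
  Matrix.diagonal fun n => (d.kappa n : ℂ)

/-- `(A² e^{zK - ζK³} + Γ)⁻¹ K^j ϰ` for the sections. -/
noncomputable def sol (N j : ℕ) (z ζ : ℂ) : Fin N → ℂ :=
  (d.opSection N z ζ)⁻¹ *ᵥ d.kappaPow N j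

/-- The moments `⟪K^i ϰ, (A² e^{zK - ζK³} + Γ)⁻¹ K^j ϰ⟫` for the sections. -/
noncomputable def mom (N i j : ℕ) (z ζ : ℂ) : ℂ := d.kappaPow N i ⬝ᵥ d.sol N j z ζ

theorem mom_comm (N i j : ℕ) (z ζ : ℂ) : d.mom N i j z ζ = d.mom N j i z ζ := by
  rw [mom, mom, sol, sol, dotProduct_mulVec, ← mulVec_transpose, transpose_nonsing_inv,
    (d.opSection_isSymm N z ζ).eq, dotProduct_comm]

variable {d} {N : ℕ} {z ζ : ℂ}

theorem opSection_mulVec_sol (h : (d.opSection N z ζ).det ≠ 0) (j : ℕ) :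
    d.opSection N z ζ *ᵥ d.sol N j z ζ = d.kappaPow N j := by
  rw [sol, mulVec_mulVec, mul_nonsing_inv _ (isUnit_iff_ne_zero.2 h), one_mulVec]

theorem sol_dotProduct_opSection (h : (d.opSection N z ζ).det ≠ 0) (i : ℕ) (w : Fin N → ℂ) :
    d.sol N i z ζ ⬝ᵥ d.opSection N z ζ *ᵥ w = d.kappaPow N i ⬝ᵥ w := by
  rw [dotProduct_mulVec, ← mulVec_transpose, (d.opSection_isSymm N z ζ).eq,
    opSection_mulVec_sol h]

theorem kSection_pow_mulVec (m j : ℕ) :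
    d.kSection N ^ m *ᵥ d.kappaPow N j = d.kappaPow N (j + m) := by
  ext i
  rw [kSection, diagonal_pow, mulVec_diagonal]
  simp only [kappaPow, Pi.pow_apply]
  ring

theorem sol_dotProduct_kSection_pow_opSection (h : (d.opSection N z ζ).det ≠ 0) (m i j : ℕ) :
    d.sol N i z ζ ⬝ᵥ (d.kSection N ^ m * d.opSection N z ζ) *ᵥ d.sol N j z ζ =
      d.mom N (j + m) i z ζ := by
  rw [← mulVec_mulVec, opSection_mulVec_sol h, kSection_pow_mulVec, dotProduct_comm, mom]

theorem sol_dotProduct_opSection_kSection_pow (h : (d.opSection N z ζ).det ≠ 0) (m i j : ℕ) :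
    d.sol N i z ζ ⬝ᵥ (d.opSection N z ζ * d.kSection N ^ m) *ᵥ d.sol N j z ζ =
      d.mom N (i + m) j z ζ := by
  rw [← mulVec_mulVec, sol_dotProduct_opSection h, mom, ← kSection_pow_mulVec, dotProduct_mulVec,
    ← mulVec_transpose, transpose_pow, kSection, diagonal_transpose]

theorem sol_dotProduct_vecMulVec (i j k l : ℕ) :
    d.sol N i z ζ ⬝ᵥ (vecMulVec (d.kappaPow N k) (d.kappaPow N l)) *ᵥ d.sol N j z ζ =
      d.mom N k i z ζ * d.mom N l j z ζ := by
  rw [vecMulVec_mulVec, mom, mom, dotProduct_comm (d.kappaPow N k)]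
  simp [mul_comm]

theorem kappa_add_ne_zero (k l : ℕ) : (d.kappa k : ℂ) + d.kappa l ≠ 0 := by
  have := d.kappa_pos k
  have := d.kappa_pos l
  exact_mod_cast (by positivity : d.kappa k + d.kappa l ≠ 0)

theorem opSection_apply (k l : Fin N) : d.opSection N z ζ k l =
    diagonal (fun n : Fin N => d.cweight z ζ n) k l +
      (d.kappa k : ℂ) * d.kappa l / (d.kappa k + d.kappa l) := by
  simp [opSection, gamSection, gamEntry]

/-- The factor `ϰ_k + ϰ_l` cancels the denominator of `Γ`, leaving rank one. This expresses `∂_z T =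
K D` through `T` and `ϰ ϰᵀ`. -/
theorem kSection_mul_opSection_add :
    d.kSection N ^ 1 * d.opSection N z ζ + d.opSection N z ζ * d.kSection N ^ 1 =
      (2 : ℂ) • diagonal (fun n : Fin N => (d.kappa n : ℂ) * d.cweight z ζ n) +
        vecMulVec (d.kappaPow N 0) (d.kappaPow N 0) := by
  ext k l
  have h := kappa_add_ne_zero (d := d) k l
  simp only [kSection, diagonal_pow, Matrix.add_apply, diagonal_mul, mul_diagonal,
    opSection_apply, Matrix.smul_apply, vecMulVec_apply, kappaPow, Pi.pow_apply, smul_eq_mul]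
  by_cases hkl : k = l
  · subst hkl
    simp only [diagonal_apply_eq]
    field_simp
    ring
  · simp only [diagonal_apply_ne _ hkl]
    field_simp
    ring

/-- The same cancellation with `ϰ_k³ + ϰ_l³ = (ϰ_k + ϰ_l)(ϰ_k² - ϰ_k ϰ_l + ϰ_l²)`, needed for the
`ζ` derivative. -/
theorem kSection_cube_mul_opSection_add :
    d.kSection N ^ 3 * d.opSection N z ζ + d.opSection N z ζ * d.kSection N ^ 3 =
      (2 : ℂ) • diagonal (fun n : Fin N => (d.kappa n : ℂ) ^ 3 * d.cweight z ζ n) +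
        (vecMulVec (d.kappaPow N 2) (d.kappaPow N 0) -
          vecMulVec (d.kappaPow N 1) (d.kappaPow N 1) +
          vecMulVec (d.kappaPow N 0) (d.kappaPow N 2)) := by
  ext k l
  have h := kappa_add_ne_zero (d := d) k l
  simp only [kSection, diagonal_pow, Matrix.add_apply, Matrix.sub_apply, diagonal_mul,
    mul_diagonal, opSection_apply, Matrix.smul_apply, vecMulVec_apply, kappaPow, Pi.pow_apply,
    smul_eq_mul]
  by_cases hkl : k = l
  · subst hkl
    simp only [diagonal_apply_eq]
    field_simp
    ring
  · simp only [diagonal_apply_ne _ hkl]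
    field_simp
    ring

/-- Here `ϰ_k² - ϰ_l²` contains the factor `ϰ_k + ϰ_l`, and the diagonal part commutes with `K²`. -/
theorem kSection_sq_mul_opSection_sub :
    d.kSection N ^ 2 * d.opSection N z ζ - d.opSection N z ζ * d.kSection N ^ 2 =
      vecMulVec (d.kappaPow N 1) (d.kappaPow N 0) -
        vecMulVec (d.kappaPow N 0) (d.kappaPow N 1) := by
  ext k l
  have h := kappa_add_ne_zero (d := d) k l
  simp only [kSection, diagonal_pow, Matrix.sub_apply, diagonal_mul,
    mul_diagonal, opSection_apply, vecMulVec_apply, kappaPow, Pi.pow_apply]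
  by_cases hkl : k = l
  · subst hkl
    simp only [diagonal_apply_eq]
    field_simp
    ring
  · simp only [diagonal_apply_ne _ hkl]
    field_simp
    ring

/-- The commutator with `K²`, taken between `T⁻¹ϰ` and `T⁻¹Kϰ`. Besides symmetry, this is the only
relation among moments that the equation needs. -/
theorem mom_zero_three_sub (h : (d.opSection N z ζ).det ≠ 0) :
    d.mom N 0 3 z ζ - d.mom N 1 2 z ζ =
      d.mom N 0 1 z ζ ^ 2 - d.mom N 0 0 z ζ * d.mom N 1 1 z ζ := by
  have e := congrArg (fun M => d.sol N 0 z ζ ⬝ᵥ M *ᵥ d.sol N 1 z ζ)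
    (kSection_sq_mul_opSection_sub (d := d) (N := N) (z := z) (ζ := ζ))
  simp only [sub_mulVec, dotProduct_sub, sol_dotProduct_kSection_pow_opSection h,
    sol_dotProduct_opSection_kSection_pow h, sol_dotProduct_vecMulVec] at e
  rw [d.mom_comm N 0 3, d.mom_comm N 1 2]
  rw [d.mom_comm N 1 0] at e
  linear_combination e

/-- In `-⟨T⁻¹K^iϰ, K D T⁻¹K^jϰ⟩` replace `K D` by `(K T + T K - ϰ ϰᵀ)/2`; each `T` then cancels a
neighbouring inverse. -/
theorem hasDerivAt_mom_fst (h : (d.opSection N z ζ).det ≠ 0) (i j : ℕ) :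
    HasDerivAt (fun s => d.mom N i j s ζ)
      (-(d.mom N i (j + 1) z ζ + d.mom N (i + 1) j z ζ - d.mom N i 0 z ζ * d.mom N 0 j z ζ) / 2)
      z := by
  have h1 := hasDerivAt_dotProduct_inv (d.gamSection_isSymm N)
    (fun n : Fin N => d.hasDerivAt_cweight_fst z ζ n) h (d.kappaPow N i) (d.kappaPow N j)
  have e := congrArg (fun M => d.sol N i z ζ ⬝ᵥ M *ᵥ d.sol N j z ζ)
    (kSection_mul_opSection_add (d := d) (N := N) (z := z) (ζ := ζ))
  simp only [add_mulVec, dotProduct_add, sol_dotProduct_kSection_pow_opSection h,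
    sol_dotProduct_opSection_kSection_pow h, sol_dotProduct_vecMulVec, smul_mulVec,
    dotProduct_smul, smul_eq_mul] at e
  refine h1.congr_deriv ?_
  change -(d.sol N i z ζ ⬝ᵥ diagonal (fun n : Fin N => (d.kappa n : ℂ) * d.cweight z ζ n) *ᵥ
    d.sol N j z ζ) = _
  rw [d.mom_comm N i (j + 1), d.mom_comm N i 0]
  linear_combination (1 / 2) * e

theorem hasDerivAt_mom_snd (h : (d.opSection N z ζ).det ≠ 0) :
    HasDerivAt (fun s => d.mom N 0 0 z s)
      (d.mom N 0 3 z ζ - d.mom N 0 2 z ζ * d.mom N 0 0 z ζ + d.mom N 0 1 z ζ ^ 2 / 2) ζ := by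
  have h1 := hasDerivAt_dotProduct_inv (d.gamSection_isSymm N)
    (fun n : Fin N => d.hasDerivAt_cweight_snd z ζ n) h (d.kappaPow N 0) (d.kappaPow N 0)
  have e := congrArg (fun M => d.sol N 0 z ζ ⬝ᵥ M *ᵥ d.sol N 0 z ζ)
    (kSection_cube_mul_opSection_add (d := d) (N := N) (z := z) (ζ := ζ))
  simp only [add_mulVec, sub_mulVec, dotProduct_add, dotProduct_sub,
    sol_dotProduct_kSection_pow_opSection h,
    sol_dotProduct_opSection_kSection_pow h, sol_dotProduct_vecMulVec, smul_mulVec,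
    dotProduct_smul, smul_eq_mul, zero_add] at e
  refine h1.congr_deriv ?_
  change -(d.sol N 0 z ζ ⬝ᵥ diagonal (fun n : Fin N => -((d.kappa n : ℂ) ^ 3 * d.cweight z ζ n)) *ᵥ
    d.sol N 0 z ζ) = _
  rw [← diagonal_neg, neg_mulVec, dotProduct_neg, neg_neg]
  rw [d.mom_comm N 0 3, d.mom_comm N 0 2, d.mom_comm N 0 1]
  linear_combination (-1 / 2) * e

end ScatteringData

/-! ### The equation and the uniform bound for the sections -/

open Matrix

namespace ScatteringData

variable {d : ScatteringData} {N : ℕ} {z ζ : ℂ}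

theorem hasDerivAt_mom_zero_zero (h : (d.opSection N z ζ).det ≠ 0) :
    HasDerivAt (fun s => d.mom N 0 0 s ζ)
      (-d.mom N 0 1 z ζ + d.mom N 0 0 z ζ ^ 2 / 2) z := by
  refine (hasDerivAt_mom_fst h 0 0).congr_deriv ?_
  rw [zero_add, d.mom_comm N 1 0]
  ring

theorem hasDerivAt_mom_second (h : (d.opSection N z ζ).det ≠ 0) :
    HasDerivAt (fun s => -d.mom N 0 1 s ζ + d.mom N 0 0 s ζ ^ 2 / 2)
      (d.mom N 0 2 z ζ / 2 + d.mom N 1 1 z ζ / 2 - 3 / 2 * (d.mom N 0 0 z ζ * d.mom N 0 1 z ζ)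
        + d.mom N 0 0 z ζ ^ 3 / 2) z := by
  refine ((hasDerivAt_mom_fst h 0 1).neg.add
    (((hasDerivAt_mom_zero_zero h).pow 2).div_const 2)).congr_deriv ?_
  norm_num
  ring

theorem hasDerivAt_mom_third (h : (d.opSection N z ζ).det ≠ 0) :
    HasDerivAt (fun s => d.mom N 0 2 s ζ / 2 + d.mom N 1 1 s ζ / 2
        - 3 / 2 * (d.mom N 0 0 s ζ * d.mom N 0 1 s ζ) + d.mom N 0 0 s ζ ^ 3 / 2)
      (-(d.mom N 0 3 z ζ + d.mom N 1 2 z ζ - d.mom N 0 0 z ζ * d.mom N 0 2 z ζ) / 4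
        - (2 * d.mom N 1 2 z ζ - d.mom N 0 1 z ζ ^ 2) / 4
        - 3 / 2 * ((-d.mom N 0 1 z ζ + d.mom N 0 0 z ζ ^ 2 / 2) * d.mom N 0 1 z ζ
          - d.mom N 0 0 z ζ * (d.mom N 0 2 z ζ + d.mom N 1 1 z ζ
            - d.mom N 0 0 z ζ * d.mom N 0 1 z ζ) / 2)
        + 3 / 2 * d.mom N 0 0 z ζ ^ 2 * (-d.mom N 0 1 z ζ + d.mom N 0 0 z ζ ^ 2 / 2)) z := by
  have h0 := hasDerivAt_mom_zero_zero h
  refine (((((hasDerivAt_mom_fst h 0 2).div_const 2).add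
    ((hasDerivAt_mom_fst h 1 1).div_const 2)).sub
    ((h0.mul (hasDerivAt_mom_fst h 0 1)).const_mul (3 / 2 : ℂ))).add
    ((h0.pow 3).div_const 2)).congr_deriv ?_
  norm_num
  rw [d.mom_comm N 2 1, d.mom_comm N 1 0]
  ring

/-- The sections satisfy the equation. -/
theorem section_equation {U : Set ℂ} (hU : IsOpen U)
    (h : ∀ z ∈ U, (d.opSection N z ζ).det ≠ 0) (hz : z ∈ U) :
    deriv (fun s => d.mom N 0 0 z s) ζ - 3 * (deriv (fun s => d.mom N 0 0 s ζ) z) ^ 2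
      + deriv (deriv (deriv fun s => d.mom N 0 0 s ζ)) z = 0 := by
  have e1 : ∀ s ∈ U, deriv (fun s => d.mom N 0 0 s ζ) s =
      -d.mom N 0 1 s ζ + d.mom N 0 0 s ζ ^ 2 / 2 :=
    fun s hs => (hasDerivAt_mom_zero_zero (h s hs)).deriv
  have e2 : ∀ s ∈ U, deriv (deriv fun s => d.mom N 0 0 s ζ) s =
      d.mom N 0 2 s ζ / 2 + d.mom N 1 1 s ζ / 2 - 3 / 2 * (d.mom N 0 0 s ζ * d.mom N 0 1 s ζ)
        + d.mom N 0 0 s ζ ^ 3 / 2 := fun s hs => by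
    rw [(Filter.eventuallyEq_of_mem (hU.mem_nhds hs) e1).deriv_eq]
    exact (hasDerivAt_mom_second (h s hs)).deriv
  have e3 := (Filter.eventuallyEq_of_mem (hU.mem_nhds hz) e2).deriv_eq
  rw [e3, (hasDerivAt_mom_third (h z hz)).deriv, e1 z hz, (hasDerivAt_mom_snd (h z hz)).deriv]
  -- All terms cubic and quartic in the moments cancel, as does the product of moments `00` and
  -- `02`; what remains is three quarters of the relation.
  linear_combination (3 / 4) * mom_zero_three_sub (h z hz)

/-- The argument of the entry is `Im z ϰ_n - Im ζ ϰ_n³`. As `ϰ_n ≤ ϰ_1`, each term is at most `ν/2`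
in absolute value; this dictates the shape of `Ω_ν`. -/
theorem cos_mul_weight_le {ν : ℝ} (hν : 0 < ν) (hν' : ν < Real.pi / 2) (hp : (z, ζ) ∈ d.cyl ν)
    (n : ℕ) : Real.cos ν * d.weight z.re ζ.re n ≤ (d.cweight z ζ n).re := by
  have hk := d.kappa_pos n
  have hk0 := d.kappa_pos 0
  have hle : d.kappa n ≤ d.kappa 0 := d.kappa_strictAnti.antitone (Nat.zero_le n)
  obtain ⟨h1, h2⟩ := hp
  simp only at h1 h2
  set θ := z.im * d.kappa n - ζ.im * d.kappa n ^ 3 with hθ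
  have h3 : |z.im| * d.kappa n ≤ ν / 2 := by
    calc |z.im| * d.kappa n ≤ ν / (2 * d.kappa 0) * d.kappa 0 := by gcongr
      _ = ν / 2 := by field_simp
  have h4 : |ζ.im| * d.kappa n ^ 3 ≤ ν / 2 := by
    calc |ζ.im| * d.kappa n ^ 3 ≤ ν / (2 * d.kappa 0 ^ 3) * d.kappa 0 ^ 3 := by gcongr
      _ = ν / 2 := by field_simp
  have h5 : |θ| ≤ ν := by
    have e1 : |z.im * d.kappa n| = |z.im| * d.kappa n := by rw [abs_mul, abs_of_pos hk]
    have e2 : |ζ.im * d.kappa n ^ 3| = |ζ.im| * d.kappa n ^ 3 := by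
      rw [abs_mul, abs_of_pos (pow_pos hk 3)]
    have := abs_sub (z.im * d.kappa n) (ζ.im * d.kappa n ^ 3)
    rw [e1, e2] at this
    linarith
  have h6 : Real.cos ν ≤ Real.cos θ := by
    rw [← Real.cos_abs θ]
    exact Real.cos_le_cos_of_nonneg_of_le_pi (abs_nonneg _) (by linarith) h5
  have h7 : (d.cweight z ζ n).re = d.weight z.re ζ.re n * Real.cos θ := by
    have e1 : (z * d.kappa n - ζ * (d.kappa n : ℂ) ^ 3).re =
        z.re * d.kappa n - ζ.re * d.kappa n ^ 3 := by
      rw [← Complex.ofReal_pow, Complex.sub_re, Complex.re_mul_ofReal, Complex.re_mul_ofReal]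
    have e2 : (z * d.kappa n - ζ * (d.kappa n : ℂ) ^ 3).im = θ := by
      rw [← Complex.ofReal_pow, Complex.sub_im, Complex.im_mul_ofReal, Complex.im_mul_ofReal]
    rw [cweight, ← Complex.ofReal_pow, Complex.re_ofReal_mul, Complex.exp_re, e1, e2, weight]
    ring
  rw [h7, mul_comm]
  exact mul_le_mul_of_nonneg_left h6 (d.weight_pos _ _ n).le

theorem star_dotProduct_opSection (c : ℕ → ℂ) :
    star (fun n : Fin N => c n) ⬝ᵥ d.opSection N z ζ *ᵥ (fun n : Fin N => c n) =
      ∑ n ∈ Finset.range N, d.cweight z ζ n * ((‖c n‖ ^ 2 : ℝ) : ℂ)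
        + cauchyForm d.kappa (Finset.range N) c := by
  rw [opSection, add_mulVec, dotProduct_add]
  congr 1
  · rw [Finset.sum_range]
    refine Finset.sum_congr rfl fun n _ => ?_
    rw [mulVec_diagonal]
    push_cast
    rw [← Complex.conj_mul']
    simp only [Pi.star_apply, RCLike.star_def]
    ring
  · rw [cauchyForm, Finset.sum_range]
    refine Finset.sum_congr rfl fun k _ => ?_
    rw [mulVec, dotProduct, Finset.sum_range, Finset.mul_sum]
    refine Finset.sum_congr rfl fun l _ => ?_
    simp only [Pi.star_apply, RCLike.star_def, gamSection, of_apply, gamEntry]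
    ring

theorem cos_mul_le_re_star_dotProduct {ν : ℝ} (hν : 0 < ν) (hν' : ν < Real.pi / 2)
    (hp : (z, ζ) ∈ d.cyl ν) (c : ℕ → ℂ) :
    Real.cos ν * (∑ n ∈ Finset.range N, d.weight z.re ζ.re n * ‖c n‖ ^ 2
        + (cauchyForm d.kappa (Finset.range N) c).re) ≤
      (star (fun n : Fin N => c n) ⬝ᵥ d.opSection N z ζ *ᵥ (fun n : Fin N => c n)).re := by
  rw [star_dotProduct_opSection, Complex.add_re, Complex.re_sum, mul_add, Finset.mul_sum]
  refine add_le_add (Finset.sum_le_sum fun n _ => ?_) ?_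
  · rw [Complex.re_mul_ofReal, ← mul_assoc]
    exact mul_le_mul_of_nonneg_right (cos_mul_weight_le hν hν' hp n) (sq_nonneg _)
  · exact mul_le_of_le_one_left (cauchyForm_nonneg_and_bound d.kappa d.kappa_pos _ c).1
      (Real.cos_le_one ν)

theorem exists_extension (v : Fin N → ℂ) : ∃ c : ℕ → ℂ, v = fun n : Fin N => c n :=
  ⟨fun n => if h : n < N then v ⟨n, h⟩ else 0, by
    ext n
    simp⟩

theorem det_opSection_ne_zero {ν : ℝ} (hν : 0 < ν) (hν' : ν < Real.pi / 2)
    (hp : (z, ζ) ∈ d.cyl ν) : (d.opSection N z ζ).det ≠ 0 := by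
  intro h
  obtain ⟨v, hv, hv0⟩ := exists_mulVec_eq_zero_iff.2 h
  obtain ⟨c, rfl⟩ := exists_extension v
  have h1 := cos_mul_le_re_star_dotProduct (N := N) hν hν' hp c
  have hcos : 0 < Real.cos ν := Real.cos_pos_of_mem_Ioo ⟨by linarith, hν'⟩
  rw [hv0, dotProduct_zero, Complex.zero_re] at h1
  have h2 := (cauchyForm_nonneg_and_bound d.kappa d.kappa_pos (Finset.range N) c).1
  refine hv ?_
  ext n
  have h3 : ∑ n ∈ Finset.range N, d.weight z.re ζ.re n * ‖c n‖ ^ 2 ≤ 0 := by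
    by_contra hc
    have := mul_pos hcos (add_pos_of_pos_of_nonneg (not_le.1 hc) h2)
    linarith
  have h4 : ∀ n ∈ Finset.range N, 0 ≤ d.weight z.re ζ.re n * ‖c n‖ ^ 2 := fun n _ =>
    mul_nonneg (d.weight_pos _ _ n).le (sq_nonneg _)
  have h5 := (Finset.sum_eq_zero_iff_of_nonneg h4).1
    (le_antisymm h3 (Finset.sum_nonneg h4)) n (Finset.mem_range.2 n.2)
  rcases mul_eq_zero.1 h5 with h6 | h6
  · exact absurd h6 (d.weight_pos _ _ _).ne'
  · simpa using h6

theorem mom_eq_sum {c : ℕ → ℂ} (hc : d.sol N 0 z ζ = fun n : Fin N => c n) :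
    d.mom N 0 0 z ζ = ∑ n ∈ Finset.range N, (d.kappa n : ℂ) * c n := by
  rw [mom, hc, dotProduct, Finset.sum_range]
  simp [kappaPow]

/-- A Lax–Milgram estimate in the energy space at the real parts. If `w` is the section's solution
there, then `cos ν ‖w‖² ≤ |mom|` by coercivity and `|mom| = |⟨y, w⟩| ≤ ‖y‖ ‖w‖`; eliminating `‖w‖`
leaves `‖y‖² = φ`, independent of `N`. -/
theorem norm_mom_le {ν : ℝ} (hν : 0 < ν) (hν' : ν < Real.pi / 2) (hp : (z, ζ) ∈ d.cyl ν) :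
    ‖d.mom N 0 0 z ζ‖ ≤ d.phi z.re ζ.re / Real.cos ν := by
  have hcos : 0 < Real.cos ν := Real.cos_pos_of_mem_Ioo ⟨by linarith, hν'⟩
  obtain ⟨-, τ, y, hτ, hy, hphi, -⟩ := d.exists_energyFrame z.re ζ.re
  obtain ⟨c, hc⟩ := exists_extension (d.sol N 0 z ζ)
  have h1 := cos_mul_le_re_star_dotProduct (N := N) hν hν' hp c
  rw [← hτ.norm_sum_sq, ← hc, opSection_mulVec_sol (det_opSection_ne_zero hν hν' hp)] at h1
  have h2 : star (d.sol N 0 z ζ) ⬝ᵥ d.kappaPow N 0 = conj (d.mom N 0 0 z ζ) := by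
    rw [mom, dotProduct_comm, dotProduct, dotProduct, map_sum]
    refine Finset.sum_congr rfl fun n _ => ?_
    simp [kappaPow]
  have h3 : d.mom N 0 0 z ζ = ⟪y, ∑ n ∈ Finset.range N, c n • τ n⟫_ℂ := by
    rw [mom_eq_sum hc, inner_sum]
    refine Finset.sum_congr rfl fun n _ => ?_
    rw [inner_smul_right, ← inner_conj_symm, hy, Complex.conj_ofReal, mul_comm]
  set w := ∑ n ∈ Finset.range N, c n • τ n
  have h4 : Real.cos ν * ‖w‖ ^ 2 ≤ ‖d.mom N 0 0 z ζ‖ := by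
    refine h1.trans ?_
    rw [h2, Complex.conj_re]
    exact Complex.re_le_norm _
  have h5 : ‖d.mom N 0 0 z ζ‖ ≤ ‖y‖ * ‖w‖ := by
    rw [h3]
    exact norm_inner_le_norm _ _
  rw [hphi, le_div_iff₀ hcos]
  set s := ‖d.mom N 0 0 z ζ‖
  rcases (norm_nonneg (d.mom N 0 0 z ζ)).eq_or_lt with h0 | h0
  · have : s = 0 := h0.symm
    rw [this, zero_mul]
    positivity
  · have h6 : s ^ 2 ≤ (‖y‖ * ‖w‖) ^ 2 := by gcongr
    have h7 : Real.cos ν * s ^ 2 ≤ ‖y‖ ^ 2 * s := by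
      calc Real.cos ν * s ^ 2 ≤ Real.cos ν * (‖y‖ * ‖w‖) ^ 2 := by gcongr
        _ = ‖y‖ ^ 2 * (Real.cos ν * ‖w‖ ^ 2) := by ring
        _ ≤ ‖y‖ ^ 2 * s := by gcongr
    have h8 : s * (s * Real.cos ν) ≤ s * ‖y‖ ^ 2 := by linarith
    exact le_of_mul_le_mul_left h8 h0

end ScatteringData

/-! ### Galerkin convergence -/

/-- Convergence of the Galerkin approximations for a coercive operator. -/
theorem tendsto_galerkin {E : Type*} [NormedAddCommGroup E] [InnerProductSpace ℂ E]
    [CompleteSpace E] {τ : ℕ → E} (hτ : ∀ y, (∀ n, ⟪τ n, y⟫_ℂ = 0) → y = 0) {B : E →L[ℂ] E}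
    {m : ℝ} (hm : 0 < m) (hB : ∀ v, m * ‖v‖ ^ 2 ≤ (⟪v, B v⟫_ℂ).re) (u : E) (c : ℕ → ℕ → ℂ)
    (hc : ∀ N, ∀ n < N, ⟪τ n, B (∑ k ∈ Finset.range N, c N k • τ k)⟫_ℂ = ⟪τ n, B u⟫_ℂ) :
    Tendsto (fun N => ∑ k ∈ Finset.range N, c N k • τ k) atTop (𝓝 u) := by
  have hd : Dense (Submodule.span ℂ (Set.range τ) : Set E) := by
    rw [← Finsupp.range_linearCombination]
    exact denseRange_linearCombination hτ
  rw [Metric.tendsto_atTop]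
  intro ε hε
  -- Tuned to Céa's estimate `m ‖u - w‖ ≤ ‖B‖ ‖u - v‖`; the added `1` covers `B = 0`.
  set δ := m * ε / (‖B‖ + 1) with hδ
  have hδ0 : 0 < δ := by positivity
  obtain ⟨v, hv, huv⟩ := Metric.dense_iff.1 hd u δ hδ0
  obtain ⟨b, rfl⟩ := Finsupp.mem_span_range_iff_exists_finsupp.1 huv
  rw [Metric.mem_ball, dist_comm, dist_eq_norm] at hv
  set v := b.sum fun i a => a • τ i with hvdef
  refine ⟨b.support.sup id + 1, fun N hN => ?_⟩
  set w := ∑ k ∈ Finset.range N, c N k • τ k with hw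
  rw [dist_comm, dist_eq_norm]
  have h0 : ∀ n < N, ⟪τ n, B (u - w)⟫_ℂ = 0 := fun n hn => by
    rw [map_sub, inner_sub_right, hc N n hn, sub_self]
  have h1 : ⟪v, B (u - w)⟫_ℂ = 0 := by
    rw [hvdef, Finsupp.sum, sum_inner]
    refine Finset.sum_eq_zero fun n hn => ?_
    have : n ≤ b.support.sup id := Finset.le_sup (f := id) hn
    rw [inner_smul_left, h0 n (by omega), mul_zero]
  have h2 : ⟪w, B (u - w)⟫_ℂ = 0 := by
    rw [hw, sum_inner]
    refine Finset.sum_eq_zero fun n hn => ?_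
    rw [inner_smul_left, ← hw, h0 n (Finset.mem_range.1 hn), mul_zero]
  -- Galerkin orthogonality: both `v` and `w` lie in the span of the first `N` vectors, so `v` may
  -- replace `w` on the left.
  have h3 : ⟪u - w, B (u - w)⟫_ℂ = ⟪u - v, B (u - w)⟫_ℂ := by
    rw [inner_sub_left, inner_sub_left, h1, h2]
  have h4 : m * ‖u - w‖ ^ 2 ≤ ‖u - v‖ * (‖B‖ * ‖u - w‖) := by
    refine (hB (u - w)).trans ?_
    rw [h3]
    refine (Complex.re_le_norm _).trans ((norm_inner_le_norm _ _).trans ?_)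
    gcongr
    exact B.le_opNorm _
  rcases (norm_nonneg (u - w)).eq_or_lt with h5 | h5
  · rwa [← h5]
  · have h6 : m * ‖u - w‖ ≤ ‖u - v‖ * ‖B‖ := by
      refine le_of_mul_le_mul_right ?_ h5
      linarith
    have h7 : ‖u - v‖ * ‖B‖ < δ * (‖B‖ + 1) := by
      have := norm_nonneg B
      nlinarith [norm_nonneg (u - v)]
    have h8 : δ * (‖B‖ + 1) = m * ε := by
      rw [hδ]
      field_simp
    have h9 : m * ‖u - w‖ < m * ε := by linarith
    exact lt_of_mul_lt_mul_left h9 hm.le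

/-! ### The analytic family of coercive operators in a fixed energy space -/

namespace ScatteringData

variable (d : ScatteringData)

theorem norm_kappa_le (n : ℕ) : ‖(d.kappa n : ℂ)‖ ≤ d.kappa 0 := by
  rw [Complex.norm_real, Real.norm_of_nonneg (d.kappa_pos n).le]
  exact d.kappa_strictAnti.antitone (Nat.zero_le n)

/-- The bounded operator `K`. -/
noncomputable def kOp : EllTwo →L[ℂ] EllTwo := EllTwo.diagOp _ _ d.norm_kappa_le

theorem kOp_pow_apply (m : ℕ) (f : EllTwo) (n : ℕ) :
    (d.kOp ^ m) f n = (d.kappa n : ℂ) ^ m * f n := by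
  induction m generalizing f with
  | zero => simp
  | succ m ih =>
    rw [pow_succ]
    change (d.kOp ^ m) (d.kOp f) n = _
    rw [ih, kOp, EllTwo.diagOp_apply]
    ring

/-- The exponent `zK - ζK³`. -/
noncomputable def exponentOp : ℂ × ℂ →L[ℂ] (EllTwo →L[ℂ] EllTwo) :=
  (ContinuousLinearMap.fst ℂ ℂ ℂ).smulRight d.kOp -
    (ContinuousLinearMap.snd ℂ ℂ ℂ).smulRight (d.kOp ^ 3)

theorem exponentOp_apply (p : ℂ × ℂ) (f : EllTwo) (n : ℕ) :
    d.exponentOp p f n = (p.1 * d.kappa n - p.2 * (d.kappa n : ℂ) ^ 3) * f n := by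
  change p.1 * (d.kOp f n) - p.2 * ((d.kOp ^ 3) f n) = _
  rw [kOp_pow_apply, kOp, EllTwo.diagOp_apply]
  ring

/-- The bounded operator `e^{zK - ζK³}`. -/
noncomputable def expOp (p : ℂ × ℂ) : EllTwo →L[ℂ] EllTwo := NormedSpace.exp (d.exponentOp p)

theorem expOp_apply (p : ℂ × ℂ) (f : EllTwo) (n : ℕ) :
    d.expOp p f n = Complex.exp (p.1 * d.kappa n - p.2 * (d.kappa n : ℂ) ^ 3) * f n := by
  set a := p.1 * (d.kappa n : ℂ) - p.2 * (d.kappa n : ℂ) ^ 3 with ha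
  have hpow : ∀ k (f : EllTwo), (d.exponentOp p ^ k) f n = a ^ k * f n := by
    intro k
    induction k with
    | zero => simp
    | succ k ih =>
      intro f
      rw [pow_succ]
      change (d.exponentOp p ^ k) (d.exponentOp p f) n = _
      rw [ih, exponentOp_apply, ← ha]
      ring
  have h1 := NormedSpace.exp_series_hasSum_exp' (𝕂 := ℂ) (d.exponentOp p)
  have h2 := (h1.mapL (ContinuousLinearMap.apply ℂ EllTwo f)).mapL (EllTwo.coord n)
  have h3 := (NormedSpace.exp_series_hasSum_exp' (𝕂 := ℂ) a).mul_right (f n)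
  rw [← Complex.exp_eq_exp_ℂ] at h3
  have e : (fun k : ℕ => EllTwo.coord n ((ContinuousLinearMap.apply ℂ EllTwo f)
      ((k.factorial : ℂ)⁻¹ • d.exponentOp p ^ k))) =
        fun k : ℕ => (k.factorial : ℂ)⁻¹ • a ^ k * f n := by
    funext k
    change ((k.factorial : ℂ)⁻¹ • (d.exponentOp p ^ k) f) n = _
    rw [lp.coeFn_smul, Pi.smul_apply, hpow, smul_eq_mul, smul_eq_mul]
    ring
  rw [e] at h2
  exact h2.unique h3

theorem analyticAt_expOp (p : ℂ × ℂ) : AnalyticAt ℂ d.expOp p :=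
  (NormedSpace.exp_analytic (𝕂 := ℂ) (d.exponentOp p)).comp (d.exponentOp.analyticAt p)

theorem cweight_eq (p : ℂ × ℂ) (n : ℕ) : d.cweight p.1 p.2 n =
    d.weight 0 0 n * Complex.exp (p.1 * d.kappa n - p.2 * (d.kappa n : ℂ) ^ 3) := by
  rw [cweight, weight]
  simp

variable {d}

/-- `V` represents the square root of the diagonal part on the energy space. It is contractive
because the Gram matrix exceeds that part by `Γ ≥ 0`. -/
theorem IsEnergyFrame.exists_contraction {δ : ℕ → ℝ} {τ : ℕ → EllTwo} (h : d.IsEnergyFrame δ τ)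
    (hδ : ∀ n, 0 < δ n) : ∃ V : EllTwo →L[ℂ] EllTwo, (∀ f, ‖V f‖ ≤ ‖f‖) ∧
      ∀ n, V (τ n) = (√(δ n) : ℂ) • EllTwo.basisVec n := by
  set e := Finsupp.linearCombination ℂ τ with he
  set f := Finsupp.linearCombination ℂ (fun n => (√(δ n) : ℂ) • EllTwo.basisVec n) with hf
  have hd : DenseRange e := denseRange_linearCombination h.total
  have hn : ∀ x, ‖f x‖ ≤ 1 * ‖e x‖ := fun x => by
    rw [one_mul]
    refine le_of_abs_le (abs_le_of_sq_le_sq ?_ (norm_nonneg _))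
    have h1 : e x = ∑ n ∈ x.support, x n • τ n := by
      simp [he, Finsupp.linearCombination_apply, Finsupp.sum]
    have h2 : f x = ∑ n ∈ x.support, lp.single 2 n (x n * (√(δ n) : ℂ)) := by
      simp only [hf, Finsupp.linearCombination_apply, Finsupp.sum, EllTwo.basisVec]
      refine Finset.sum_congr rfl fun n _ => ?_
      rw [← lp.single_smul, ← lp.single_smul]
      simp
    have h3 : ‖f x‖ ^ 2 = ∑ n ∈ x.support, ‖x n * (√(δ n) : ℂ)‖ ^ 2 := by
      have := lp.norm_sum_single (p := 2) (E := fun _ : ℕ => ℂ) (by norm_num)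
        (fun n => x n * (√(δ n) : ℂ)) x.support
      rw [h2]
      simpa using this
    rw [h3, h1, h.norm_sum_sq]
    have h4 := (cauchyForm_nonneg_and_bound d.kappa d.kappa_pos x.support x).1
    refine le_trans (le_of_eq ?_) (le_add_of_nonneg_right h4)
    refine Finset.sum_congr rfl fun n _ => ?_
    rw [norm_mul, Complex.norm_real, Real.norm_of_nonneg (Real.sqrt_nonneg _), mul_pow,
      Real.sq_sqrt (hδ n).le, mul_comm]
  refine ⟨f.extendOfNorm e, fun g => ?_, fun n => ?_⟩
  · simpa using LinearMap.norm_extendOfNorm_apply_le hd 1 hn g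
  · have h1 : τ n = e (Finsupp.single n 1) := by simp [he]
    rw [h1, LinearMap.extendOfNorm_eq hd ⟨1, hn⟩]
    simp [hf]

variable (d)

/-- The operator `A² e^{zK - ζK³} + Γ`, transported to the energy space of `A² + Γ`. -/
noncomputable def formOp (V : EllTwo →L[ℂ] EllTwo) (p : ℂ × ℂ) : EllTwo →L[ℂ] EllTwo :=
  1 + ContinuousLinearMap.adjoint V * ((d.expOp p - 1) * V)

theorem analyticAt_formOp (V : EllTwo →L[ℂ] EllTwo) (p : ℂ × ℂ) :
    AnalyticAt ℂ (d.formOp V) p :=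
  analyticAt_const.add (analyticAt_const.mul
    (((d.analyticAt_expOp p).sub analyticAt_const).mul analyticAt_const))

variable {d}

theorem inner_formOp (V : EllTwo →L[ℂ] EllTwo) (p : ℂ × ℂ) (f g : EllTwo) :
    ⟪f, d.formOp V p g⟫_ℂ = ⟪f, g⟫_ℂ + (⟪V f, d.expOp p (V g)⟫_ℂ - ⟪V f, V g⟫_ℂ) := by
  change ⟪f, g + ContinuousLinearMap.adjoint V (d.expOp p (V g) - V g)⟫_ℂ = _
  rw [inner_add_right, ContinuousLinearMap.adjoint_inner_right, inner_sub_right]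

theorem exists_le_re_inner_expOp {p : ℂ × ℂ} {ν : ℝ} (hν : 0 < ν) (hν' : ν < Real.pi / 2)
    (hp : p ∈ d.cyl ν) : ∃ m : ℝ, 0 < m ∧ m ≤ 1 ∧
      ∀ f, m * ‖f‖ ^ 2 ≤ (⟪f, d.expOp p f⟫_ℂ).re := by
  have hcos : 0 < Real.cos ν := Real.cos_pos_of_mem_Ioo ⟨by linarith, hν'⟩
  set r := |p.1.re| * d.kappa 0 + |p.2.re| * d.kappa 0 ^ 3 with hr
  have hk0 := d.kappa_pos 0
  have hr0 : 0 ≤ r := by positivity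
  refine ⟨Real.cos ν * Real.exp (-r), by positivity, ?_, fun f => ?_⟩
  · exact mul_le_one₀ (Real.cos_le_one ν) (Real.exp_pos _).le (Real.exp_le_one_iff.2 (by linarith))
  have h1 := Complex.hasSum_re (EllTwo.hasSum_inner f (d.expOp p f))
  refine hasSum_le (fun n => ?_) ((EllTwo.hasSum_norm_sq f).mul_left _) h1
  have hk := d.kappa_pos n
  have hle : d.kappa n ≤ d.kappa 0 := d.kappa_strictAnti.antitone (Nat.zero_le n)
  have hw0 : 0 < d.weight 0 0 n := d.weight_pos 0 0 n
  have h2 := cos_mul_weight_le hν hν' (z := p.1) (ζ := p.2) hp n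
  rw [cweight_eq, Complex.re_ofReal_mul] at h2
  have h3 : d.weight p.1.re p.2.re n =
      d.weight 0 0 n * Real.exp (p.1.re * d.kappa n - p.2.re * d.kappa n ^ 3) := by
    simp [weight]
  rw [h3, mul_left_comm] at h2
  have h4 := le_of_mul_le_mul_left h2 hw0
  have h5 : Real.exp (-r) ≤ Real.exp (p.1.re * d.kappa n - p.2.re * d.kappa n ^ 3) := by
    refine Real.exp_le_exp.2 ?_
    have e1 : -(|p.1.re| * d.kappa 0) ≤ p.1.re * d.kappa n := by
      have : |p.1.re * d.kappa n| ≤ |p.1.re| * d.kappa 0 := by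
        rw [abs_mul, abs_of_pos hk]
        gcongr
      exact (abs_le.1 this).1
    have e2 : p.2.re * d.kappa n ^ 3 ≤ |p.2.re| * d.kappa 0 ^ 3 := by
      have : |p.2.re * d.kappa n ^ 3| ≤ |p.2.re| * d.kappa 0 ^ 3 := by
        rw [abs_mul, abs_of_pos (pow_pos hk 3)]
        gcongr
      exact (abs_le.1 this).2
    rw [hr]
    linarith
  have h6 : conj (f n) * d.expOp p f n =
      Complex.exp (p.1 * d.kappa n - p.2 * (d.kappa n : ℂ) ^ 3) * ((‖f n‖ ^ 2 : ℝ) : ℂ) := by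
    rw [expOp_apply]
    push_cast
    rw [← Complex.conj_mul']
    ring
  rw [h6, Complex.re_mul_ofReal]
  refine mul_le_mul_of_nonneg_right (le_trans ?_ h4) (sq_nonneg _)
  gcongr

/-- In `formOp` the part `1 - V*V`, representing `Γ`, is nonnegative. Since `m ≤ 1`, the lower bound
`m` of `e^{zK - ζK³}` is inherited by the sum. -/
theorem exists_formOp_coercive {V : EllTwo →L[ℂ] EllTwo} (hV : ∀ f, ‖V f‖ ≤ ‖f‖) {p : ℂ × ℂ}
    {ν : ℝ} (hν : 0 < ν) (hν' : ν < Real.pi / 2) (hp : p ∈ d.cyl ν) :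
    ∃ m : ℝ, 0 < m ∧ ∀ f, m * ‖f‖ ^ 2 ≤ (⟪f, d.formOp V p f⟫_ℂ).re := by
  obtain ⟨m, hm, hm1, h⟩ := exists_le_re_inner_expOp hν hν' hp
  refine ⟨m, hm, fun f => ?_⟩
  have h1 := h (V f)
  have e1 : (⟪f, f⟫_ℂ).re = ‖f‖ ^ 2 := inner_self_eq_norm_sq (𝕜 := ℂ) f
  have e2 : (⟪V f, V f⟫_ℂ).re = ‖V f‖ ^ 2 := inner_self_eq_norm_sq (𝕜 := ℂ) (V f)
  have h2 : ‖V f‖ ^ 2 ≤ ‖f‖ ^ 2 := by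
    gcongr
    exact hV f
  rw [inner_formOp, Complex.add_re, Complex.sub_re, e1, e2]
  nlinarith

theorem isUnit_of_coercive {B : EllTwo →L[ℂ] EllTwo} {m : ℝ} (hm : 0 < m)
    (h : ∀ f, m * ‖f‖ ^ 2 ≤ (⟪f, B f⟫_ℂ).re) : IsUnit B := by
  refine ContinuousLinearMap.isUnit_of_forall_le_norm_inner_map B (c := ⟨m, hm.le⟩) hm fun f => ?_
  rw [norm_inner_symm, mul_comm]
  exact (h f).trans (Complex.re_le_norm _)

/-- The term `V*V` removes the weight at the origin from the Gram matrix and the exponential puts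
back the weight at `p`, so the Galerkin matrix of `formOp` is the finite section. -/
theorem IsEnergyFrame.inner_formOp_sum {τ : ℕ → EllTwo} (h : d.IsEnergyFrame (d.weight 0 0) τ)
    {V : EllTwo →L[ℂ] EllTwo} (hV : ∀ n, V (τ n) = (√(d.weight 0 0 n) : ℂ) • EllTwo.basisVec n)
    (p : ℂ × ℂ) {N : ℕ} (k : Fin N) (c : ℕ → ℂ) :
    ⟪τ k, d.formOp V p (∑ n ∈ Finset.range N, c n • τ n)⟫_ℂ =
      (d.opSection N p.1 p.2 *ᵥ fun n : Fin N => c n) k := by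
  have h1 : ∀ k l : ℕ, ⟪τ k, d.formOp V p (τ l)⟫_ℂ =
      (if k = l then d.cweight p.1 p.2 k else 0) + (d.gamEntry k l : ℂ) := by
    intro k l
    have hs : (√(d.weight 0 0 k) : ℂ) * √(d.weight 0 0 k) = d.weight 0 0 k := by
      rw [← Complex.ofReal_mul, Real.mul_self_sqrt (d.weight_pos 0 0 k).le]
    rw [inner_formOp, h.gram, hV, hV, map_smul, inner_smul_left, inner_smul_right,
      EllTwo.inner_basisVec_left, expOp_apply, inner_smul_left, inner_smul_right,
      EllTwo.inner_basisVec_left, EllTwo.basisVec_apply, cweight_eq, Complex.conj_ofReal]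
    by_cases hkl : k = l
    · subst hkl
      simp only [if_true]
      rw [← hs]
      ring
    · simp [hkl]
  rw [map_sum, inner_sum, Finset.sum_range, mulVec, dotProduct]
  refine Finset.sum_congr rfl fun l _ => ?_
  rw [map_smul, inner_smul_right, h1, opSection, Matrix.add_apply, gamSection, of_apply,
    Matrix.diagonal_apply]
  simp only [Fin.val_inj]
  ring

theorem IsEnergyFrame.tendsto_mom {τ : ℕ → EllTwo} (h : d.IsEnergyFrame (d.weight 0 0) τ)
    {V : EllTwo →L[ℂ] EllTwo} (hV : ∀ n, V (τ n) = (√(d.weight 0 0 n) : ℂ) • EllTwo.basisVec n)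
    (hV1 : ∀ f, ‖V f‖ ≤ ‖f‖) {y : EllTwo} (hy : ∀ n, ⟪τ n, y⟫_ℂ = d.kappa n) {p : ℂ × ℂ}
    {ν : ℝ} (hν : 0 < ν) (hν' : ν < Real.pi / 2) (hp : p ∈ d.cyl ν) :
    Tendsto (fun N => d.mom N 0 0 p.1 p.2) atTop
      (𝓝 ⟪y, Ring.inverse (d.formOp V p) y⟫_ℂ) := by
  obtain ⟨m, hm, hB⟩ := exists_formOp_coercive hV1 hν hν' hp
  have hunit := isUnit_of_coercive hm hB
  set u := Ring.inverse (d.formOp V p) y with hu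
  have hBu : d.formOp V p u = y := by
    have := DFunLike.congr_fun (Ring.mul_inverse_cancel _ hunit) y
    exact this
  choose c hc using fun N => exists_extension (d.sol N 0 p.1 p.2)
  have hgal := tendsto_galerkin h.total hm hB u c fun N n hn => by
    have := h.inner_formOp_sum hV p ⟨n, hn⟩ (c N)
    rw [this, ← hc, opSection_mulVec_sol (det_opSection_ne_zero hν hν' hp), hBu, hy]
    simp [kappaPow]
  have h2 : Tendsto (fun N => ⟪y, ∑ k ∈ Finset.range N, c N k • τ k⟫_ℂ) atTop (𝓝 ⟪y, u⟫_ℂ) :=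
    tendsto_const_nhds.inner hgal
  refine h2.congr fun N => ?_
  rw [mom_eq_sum (hc N), inner_sum]
  refine Finset.sum_congr rfl fun n _ => ?_
  rw [inner_smul_right, ← inner_conj_symm, hy, Complex.conj_ofReal, mul_comm]

/-- Galerkin with `B = 1` in the energy space of `(x, t)` itself. Since the sections do not depend
on the frame, `φ` is identified with the continuation without comparing energy spaces. -/
theorem tendsto_mom_ofReal (x t : ℝ) :
    Tendsto (fun N => d.mom N 0 0 x t) atTop (𝓝 (d.phi x t : ℂ)) := by
  obtain ⟨-, τ, y, h, hy, hphi, -⟩ := d.exists_energyFrame x t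
  have hk0 := d.kappa_pos 0
  have hp : ((x : ℂ), (t : ℂ)) ∈ d.cyl 1 := by
    simp only [cyl, Set.mem_ofPred_eq, Complex.ofReal_im, abs_zero]
    constructor <;> positivity
  have hdet : ∀ N, (d.opSection N x t).det ≠ 0 := fun N =>
    det_opSection_ne_zero one_pos (by linarith [Real.pi_gt_three]) hp
  choose c hc using fun N => exists_extension (d.sol N 0 x t)
  have hgal := tendsto_galerkin h.total one_pos (B := 1)
    (fun v => by
      rw [one_mul]
      exact (inner_self_eq_norm_sq (𝕜 := ℂ) v).ge) y c fun N n hn => by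
    have h1 := congrFun (opSection_mulVec_sol (hdet N) 0) ⟨n, hn⟩
    rw [hc] at h1
    change ⟪τ n, ∑ k ∈ Finset.range N, c N k • τ k⟫_ℂ = ⟪τ n, y⟫_ℂ
    rw [hy, inner_sum, Finset.sum_range]
    simp only [kappaPow, zero_add, pow_one] at h1
    rw [← h1, mulVec, dotProduct]
    refine Finset.sum_congr rfl fun l _ => ?_
    rw [inner_smul_right, h.gram, opSection, Matrix.add_apply, gamSection, of_apply,
      Matrix.diagonal_apply, cweight_ofReal]
    simp only [Fin.ext_iff]
    by_cases hnl : n = (l : ℕ)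
    · simp [hnl, mul_comm]
    · simp [hnl, mul_comm]
  have h2 : Tendsto (fun N => ⟪y, ∑ k ∈ Finset.range N, c N k • τ k⟫_ℂ) atTop (𝓝 ⟪y, y⟫_ℂ) :=
    tendsto_const_nhds.inner hgal
  have e : ⟪y, y⟫_ℂ = (d.phi x t : ℂ) := by
    rw [hphi, inner_self_eq_norm_sq_to_K]
    push_cast
    rfl
  rw [e] at h2
  refine h2.congr fun N => ?_
  rw [mom_eq_sum (hc N), inner_sum]
  refine Finset.sum_congr rfl fun n _ => ?_
  rw [inner_smul_right, ← inner_conj_symm, hy, Complex.conj_ofReal, mul_comm]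

end ScatteringData

/-! ### Limits of locally bounded holomorphic sequences -/

/-- A sequence of functions that is bounded uniformly near every point of `U`. -/
def IsLocallyBoundedSeq (F : ℕ → ℂ → ℂ) (U : Set ℂ) : Prop :=
  ∀ z ∈ U, ∃ r > 0, ∃ M : ℝ, Metric.closedBall z r ⊆ U ∧
    ∀ N, ∀ w ∈ Metric.closedBall z r, ‖F N w‖ ≤ M

/-- Cauchy's estimate on discs of half the radius. -/
theorem IsLocallyBoundedSeq.deriv {F : ℕ → ℂ → ℂ} {U : Set ℂ} (h : IsLocallyBoundedSeq F U)
    (hF : ∀ N, DifferentiableOn ℂ (F N) U) : IsLocallyBoundedSeq (fun N => deriv (F N)) U := by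
  intro z hz
  obtain ⟨r, hr, M, hrU, hM⟩ := h z hz
  have hr2 : 0 < r / 2 := by positivity
  refine ⟨r / 2, hr2, M / (r / 2), (Metric.closedBall_subset_closedBall (by linarith)).trans hrU,
    fun N w hw => ?_⟩
  have hsub : Metric.closedBall w (r / 2) ⊆ Metric.closedBall z r := by
    refine Metric.closedBall_subset_closedBall' ?_
    have := Metric.mem_closedBall.1 hw
    linarith
  refine Complex.norm_deriv_le_of_forall_mem_sphere_norm_le hr2 ?_ fun s hs =>
    hM N s (hsub (Metric.sphere_subset_closedBall hs))
  refine DifferentiableOn.diffContOnCl ((hF N).mono ?_)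
  rw [closure_ball _ hr2.ne']
  exact hsub.trans hrU

/-- Cauchy's formula for the derivative and dominated convergence on the circle; pointwise
convergence suffices. -/
theorem IsLocallyBoundedSeq.tendsto_deriv {F : ℕ → ℂ → ℂ} {f : ℂ → ℂ} {U : Set ℂ}
    (h : IsLocallyBoundedSeq F U) (hF : ∀ N, DifferentiableOn ℂ (F N) U)
    (hf : DifferentiableOn ℂ f U) (hlim : ∀ z ∈ U, Tendsto (fun N => F N z) atTop (𝓝 (f z)))
    {z : ℂ} (hz : z ∈ U) :
    Tendsto (fun N => _root_.deriv (F N) z) atTop (𝓝 (_root_.deriv f z)) := by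
  obtain ⟨r, hr, M, hrU, hM⟩ := h z hz
  have hdc : ∀ g : ℂ → ℂ, DifferentiableOn ℂ g U → DiffContOnCl ℂ g (Metric.ball z r) :=
    fun g hg => DifferentiableOn.diffContOnCl (hg.mono (by
      rw [closure_ball _ hr.ne']
      exact hrU))
  have hcm : ∀ θ, circleMap z r θ ∈ Metric.closedBall z r := fun θ =>
    circleMap_mem_closedBall z hr.le θ
  have e : ∀ g : ℂ → ℂ, DifferentiableOn ℂ g U →
      _root_.deriv g z = (2 * Real.pi * Complex.I : ℂ)⁻¹ •
        ∮ w in C(z, r), (1 / (w - z) ^ 2) • g w := fun g hg => by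
    rw [DiffContOnCl.deriv_eq_smul_circleIntegral hr (hdc g hg), inv_smul_smul₀]
    simp [Real.pi_ne_zero]
  rw [e f hf]
  simp only [fun N => e (F N) (hF N)]
  refine Tendsto.const_smul ?_ _
  simp only [circleIntegral]
  refine intervalIntegral.tendsto_integral_filter_of_dominated_convergence
    (fun _ => r * (1 / r ^ 2 * M)) ?_ ?_ ?_ ?_
  · refine Eventually.of_forall fun N => Continuous.aestronglyMeasurable ?_
    have h1 : Continuous fun θ => F N (circleMap z r θ) :=
      ((hF N).continuousOn.mono hrU).comp_continuous (continuous_circleMap z r) hcm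
    have h2 : Continuous fun θ => 1 / (circleMap z r θ - z) ^ 2 := by
      refine continuous_const.div (by fun_prop) fun θ => pow_ne_zero 2 ?_
      simp [circleMap_ne_center hr.ne']
    simp only [deriv_circleMap]
    exact (by fun_prop : Continuous fun θ => circleMap 0 r θ * Complex.I).smul (h2.smul h1)
  · refine Eventually.of_forall fun N => Eventually.of_forall fun θ _ => ?_
    rw [norm_smul, norm_smul, deriv_circleMap, norm_div, norm_pow, norm_one]
    have h1 : ‖circleMap z r θ - z‖ = r := by simp [circleMap, abs_of_pos hr]
    have h2 : ‖circleMap 0 r θ * Complex.I‖ = r := by simp [circleMap, abs_of_pos hr]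
    rw [h1, h2]
    gcongr
    exact hM N _ (hcm θ)
  · simp
  · refine Eventually.of_forall fun θ _ => ?_
    exact ((hlim _ (hrU (hcm θ))).const_smul _).const_smul _

theorem deriv_ofReal_eq {F : ℂ → ℂ} {f : ℝ → ℝ} (h : ∀ x : ℝ, F x = f x)
    (hF : ∀ x : ℝ, DifferentiableAt ℂ F x) (x : ℝ) : deriv F x = ((deriv f x : ℝ) : ℂ) := by
  have h1 : HasDerivAt (fun y : ℝ => (f y : ℂ)) (deriv F x) x := by
    simpa only [h] using (hF x).hasDerivAt.comp_ofReal
  have h2 : HasDerivAt f (deriv F x).re x := by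
    simpa only [h, Complex.ofReal_re] using (hF x).hasDerivAt.real_of_complex
  rw [h2.deriv]
  exact h1.unique h2.ofReal_comp

/-! ### The continuation and passage to the limit in the equation -/

namespace ScatteringData

variable (d : ScatteringData)

theorem phi_nonneg (x t : ℝ) : 0 ≤ d.phi x t := by
  obtain ⟨-, -, y, -, -, hphi, -⟩ := d.exists_energyFrame x t
  rw [hphi]
  positivity

theorem phi_le (x t : ℝ) : d.phi x t ≤ 2 * ∑' j, d.kappa j := by
  obtain ⟨-, -, y, -, -, hphi, hy⟩ := d.exists_energyFrame x t
  rwa [hphi]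

theorem isOpen_cyl (ν : ℝ) : IsOpen (d.cyl ν) :=
  (isOpen_lt (f := fun p : ℂ × ℂ => |p.1.im|) (by fun_prop) continuous_const).inter
    (isOpen_lt (f := fun p : ℂ × ℂ => |p.2.im|) (by fun_prop) continuous_const)

theorem cyl_mono {ν ν' : ℝ} (h : ν ≤ ν') : d.cyl ν ⊆ d.cyl ν' := by
  have hk0 := d.kappa_pos 0
  rintro p ⟨h1, h2⟩
  exact ⟨h1.trans_le (by gcongr), h2.trans_le (by gcongr)⟩

theorem exists_mem_cyl {p : ℂ × ℂ} (hp : p ∈ d.cyl (Real.pi / 2)) :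
    ∃ ν, 0 < ν ∧ ν < Real.pi / 2 ∧ p ∈ d.cyl ν := by
  have hk0 := d.kappa_pos 0
  have hk3 : 0 < 2 * d.kappa 0 ^ 3 := by positivity
  obtain ⟨h1, h2⟩ := hp
  rw [lt_div_iff₀ (by positivity)] at h1 h2
  obtain ⟨ν, hν, hν'⟩ := exists_between (max_lt h1 h2)
  refine ⟨ν, ?_, hν', ?_, ?_⟩
  · refine lt_of_le_of_lt ?_ hν
    exact le_max_of_le_left (by positivity)
  · rw [lt_div_iff₀ (by positivity)]
    exact (le_max_left _ _).trans_lt hν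
  · rw [lt_div_iff₀ hk3]
    exact (le_max_right _ _).trans_lt hν

/-- The frame and `y` are fixed at the origin, so `p` enters only through the analytic `formOp`, and
inversion is analytic at units. -/
theorem exists_continuation : ∃ Φ : ℂ × ℂ → ℂ, AnalyticOnNhd ℂ Φ (d.cyl (Real.pi / 2)) ∧
    ∀ p ∈ d.cyl (Real.pi / 2), Tendsto (fun N => d.mom N 0 0 p.1 p.2) atTop (𝓝 (Φ p)) := by
  obtain ⟨-, τ, y, h, hy, -, -⟩ := d.exists_energyFrame 0 0
  obtain ⟨V, hV1, hV⟩ := h.exists_contraction (d.weight_pos 0 0)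
  refine ⟨fun p => ⟪y, Ring.inverse (d.formOp V p) y⟫_ℂ, fun p hp => ?_, fun p hp => ?_⟩
  · obtain ⟨ν, hν, hν', hp'⟩ := d.exists_mem_cyl hp
    obtain ⟨m, hm, hB⟩ := exists_formOp_coercive hV1 hν hν' hp'
    have hunit := isUnit_of_coercive hm hB
    have h1 : AnalyticAt ℂ Ring.inverse (d.formOp V p) := analyticAt_inverse hunit.unit
    have h2 := h1.comp (d.analyticAt_formOp V p)
    exact (((innerSL ℂ y).comp (ContinuousLinearMap.apply ℂ EllTwo y)).analyticAt _).comp h2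
  · obtain ⟨ν, hν, hν', hp'⟩ := d.exists_mem_cyl hp
    exact h.tendsto_mom hV hV1 hy hν hν' hp'

variable {d}

theorem ofReal_mem_cyl {ν : ℝ} (hν : 0 < ν) (x t : ℝ) : ((x : ℂ), (t : ℂ)) ∈ d.cyl ν := by
  have hk0 := d.kappa_pos 0
  simp only [cyl, Set.mem_ofPred_eq, Complex.ofReal_im, abs_zero]
  constructor <;> positivity

theorem isLocallyBoundedSeq_mom {g : ℂ → ℂ × ℂ} (hg : Continuous g) :
    IsLocallyBoundedSeq (fun N w => d.mom N 0 0 (g w).1 (g w).2)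
      (g ⁻¹' d.cyl (Real.pi / 2)) := by
  intro z hz
  obtain ⟨ν, hν, hν', hp⟩ := d.exists_mem_cyl hz
  have hcos : 0 < Real.cos ν := Real.cos_pos_of_mem_Ioo ⟨by linarith, hν'⟩
  obtain ⟨r, hr, hrU⟩ := Metric.nhds_basis_closedBall.mem_iff.1
    (((d.isOpen_cyl ν).preimage hg).mem_nhds hp)
  refine ⟨r, hr, 2 * (∑' j, d.kappa j) / Real.cos ν,
    hrU.trans (Set.preimage_mono (d.cyl_mono hν'.le)), fun N w hw => ?_⟩
  refine (norm_mom_le hν hν' (hrU hw)).trans ?_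
  gcongr
  exact d.phi_le _ _

theorem differentiableOn_mom_fst (N : ℕ) (ζ : ℂ) : DifferentiableOn ℂ
    (fun z => d.mom N 0 0 z ζ) ((fun z => (z, ζ)) ⁻¹' d.cyl (Real.pi / 2)) := by
  intro z hz
  obtain ⟨ν, hν, hν', hp⟩ := d.exists_mem_cyl hz
  exact (hasDerivAt_mom_fst (det_opSection_ne_zero hν hν' hp) 0
    0).differentiableAt.differentiableWithinAt

theorem differentiableOn_mom_snd (N : ℕ) (z : ℂ) : DifferentiableOn ℂ
    (fun ζ => d.mom N 0 0 z ζ) ((fun ζ => (z, ζ)) ⁻¹' d.cyl (Real.pi / 2)) := by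
  intro ζ hζ
  obtain ⟨ν, hν, hν', hp⟩ := d.exists_mem_cyl hζ
  exact (hasDerivAt_mom_snd
    (det_opSection_ne_zero hν hν' hp)).differentiableAt.differentiableWithinAt

/-- A holomorphic limit of the sections satisfies the equation. -/
theorem equation_of_tendsto {Φ : ℂ × ℂ → ℂ} (hΦ : AnalyticOnNhd ℂ Φ (d.cyl (Real.pi / 2)))
    (hlim : ∀ p ∈ d.cyl (Real.pi / 2), Tendsto (fun N => d.mom N 0 0 p.1 p.2) atTop (𝓝 (Φ p)))
    {z ζ : ℂ} (hp : (z, ζ) ∈ d.cyl (Real.pi / 2)) :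
    deriv (fun s => Φ (z, s)) ζ - 3 * (deriv (fun s => Φ (s, ζ)) z) ^ 2
      + deriv (deriv (deriv fun s => Φ (s, ζ))) z = 0 := by
  set U : Set ℂ := (fun s => (s, ζ)) ⁻¹' d.cyl (Real.pi / 2)
  set W : Set ℂ := (fun s => (z, s)) ⁻¹' d.cyl (Real.pi / 2)
  have hU : IsOpen U := (d.isOpen_cyl _).preimage (by fun_prop)
  have hW : IsOpen W := (d.isOpen_cyl _).preimage (by fun_prop)
  have hz : z ∈ U := hp
  have hζ : ζ ∈ W := hp
  have fU : DifferentiableOn ℂ (fun s => Φ (s, ζ)) U := fun s hs =>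
    ((hΦ _ hs).comp₂ (f := fun s : ℂ => s) (g := fun _ => ζ) analyticAt_id
      analyticAt_const).differentiableAt.differentiableWithinAt
  have fW : DifferentiableOn ℂ (fun s => Φ (z, s)) W := fun s hs =>
    ((hΦ _ hs).comp₂ (f := fun _ => z) (g := fun s : ℂ => s) analyticAt_const
      analyticAt_id).differentiableAt.differentiableWithinAt
  have bU : IsLocallyBoundedSeq (fun N s => d.mom N 0 0 s ζ) U :=
    isLocallyBoundedSeq_mom (g := fun s => (s, ζ)) (by fun_prop)
  have bW : IsLocallyBoundedSeq (fun N s => d.mom N 0 0 z s) W :=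
    isLocallyBoundedSeq_mom (g := fun s => (z, s)) (by fun_prop)
  have dU : ∀ N, DifferentiableOn ℂ (fun s => d.mom N 0 0 s ζ) U := fun N =>
    differentiableOn_mom_fst N ζ
  have dU1 : ∀ N, DifferentiableOn ℂ (deriv fun s => d.mom N 0 0 s ζ) U := fun N =>
    (dU N).deriv hU
  have dU2 : ∀ N, DifferentiableOn ℂ (deriv (deriv fun s => d.mom N 0 0 s ζ)) U := fun N =>
    (dU1 N).deriv hU
  have t1 : ∀ s ∈ U, Tendsto (fun N => deriv (fun s => d.mom N 0 0 s ζ) s) atTop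
      (𝓝 (deriv (fun s => Φ (s, ζ)) s)) := fun s hs =>
    bU.tendsto_deriv dU fU (fun s hs => hlim (s, ζ) hs) hs
  -- The derivatives again form a locally bounded holomorphic sequence with a pointwise limit, so
  -- the convergence lemma can be iterated.
  have t2 : ∀ s ∈ U, Tendsto (fun N => deriv (deriv fun s => d.mom N 0 0 s ζ) s) atTop
      (𝓝 (deriv (deriv fun s => Φ (s, ζ)) s)) := fun s hs =>
    (bU.deriv dU).tendsto_deriv dU1 (fU.deriv hU) t1 hs
  have t3 : Tendsto (fun N => deriv (deriv (deriv fun s => d.mom N 0 0 s ζ)) z) atTop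
      (𝓝 (deriv (deriv (deriv fun s => Φ (s, ζ))) z)) :=
    ((bU.deriv dU).deriv dU1).tendsto_deriv dU2 ((fU.deriv hU).deriv hU) t2 hz
  have s1 : Tendsto (fun N => deriv (fun s => d.mom N 0 0 z s) ζ) atTop
      (𝓝 (deriv (fun s => Φ (z, s)) ζ)) :=
    bW.tendsto_deriv (fun N => differentiableOn_mom_snd N z) fW (fun s hs => hlim (z, s) hs) hζ
  have hN : ∀ N, deriv (fun s => d.mom N 0 0 z s) ζ - 3 * deriv (fun s => d.mom N 0 0 s ζ) z ^ 2
      + deriv (deriv (deriv fun s => d.mom N 0 0 s ζ)) z = 0 := fun N =>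
    section_equation hU (fun s hs => by
      obtain ⟨ν, hν, hν', hp⟩ := d.exists_mem_cyl hs
      exact det_opSection_ne_zero hν hν' hp) hz
  have key := (s1.sub (((t1 z hz).pow 2).const_mul 3)).add t3
  simp only [hN] at key
  exact tendsto_nhds_unique key tendsto_const_nhds

end ScatteringData

theorem lemma6p2 (d : ScatteringData) :
    -- the function `φ` is well defined
    (∀ x t : ℝ, IsInvSqrt (d.opT x t) (invSqrt (d.opT x t)) ∧
      d.kappaVec ∈ (invSqrt (d.opT x t)).domain) ∧
    -- `φ` is a smooth solution of the equation
    ContDiff ℝ ∞ (fun p : ℝ × ℝ => d.phi p.1 p.2) ∧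
    (∀ x t : ℝ,
      deriv (fun s => d.phi x s) t - 3 * (deriv (fun y => d.phi y t) x) ^ 2
        + iteratedDeriv 3 (fun y => d.phi y t) x = 0) ∧
    -- it has a holomorphic continuation to `Ω_{π/2}` with the stated bounds
    ∃ Φ : ℂ × ℂ → ℂ,
      AnalyticOnNhd ℂ Φ (d.cyl (Real.pi / 2)) ∧
      (∀ x t : ℝ, Φ ((x : ℂ), (t : ℂ)) = (d.phi x t : ℂ)) ∧
      ∀ ν : ℝ, 0 < ν → ν < Real.pi / 2 → ∀ p ∈ d.cyl ν,
        ‖Φ p‖ ≤ |d.phi p.1.re p.2.re| / Real.cos ν ∧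
        |d.phi p.1.re p.2.re| / Real.cos ν ≤ 2 / Real.cos ν * ∑' j, d.kappa j := by
  obtain ⟨Φ, hΦ, hlim⟩ := d.exists_continuation
  have hreal : ∀ x t : ℝ, ((x : ℂ), (t : ℂ)) ∈ d.cyl (Real.pi / 2) := fun x t =>
    ScatteringData.ofReal_mem_cyl (by positivity) x t
  have hΦphi : ∀ x t : ℝ, Φ ((x : ℂ), (t : ℂ)) = (d.phi x t : ℂ) := fun x t =>
    tendsto_nhds_unique (hlim _ (hreal x t)) (ScatteringData.tendsto_mom_ofReal x t)
  refine ⟨fun x t => (d.exists_energyFrame x t).1, ?_, fun x t => ?_, Φ, hΦ, hΦphi, ?_⟩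
  · rw [contDiff_iff_contDiffAt]
    intro p
    have h1 : ContDiffAt ℝ ∞ Φ ((p.1 : ℂ), (p.2 : ℂ)) :=
      (hΦ _ (hreal p.1 p.2)).contDiffAt.restrict_scalars ℝ
    have h2 : ContDiffAt ℝ ∞ (fun q : ℝ × ℝ => ((q.1 : ℂ), (q.2 : ℂ))) p :=
      ((Complex.ofRealCLM.contDiff.comp contDiff_fst).prodMk
        (Complex.ofRealCLM.contDiff.comp contDiff_snd)).contDiffAt
    have h3 := Complex.reCLM.contDiff.contDiffAt.comp p (ContDiffAt.comp p h1 h2)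
    refine h3.congr_of_eventuallyEq (Eventually.of_forall fun q => ?_)
    simp [hΦphi]
  · have hd : ∀ s : ℝ, AnalyticAt ℂ (fun z => Φ (z, (t : ℂ))) s := fun s =>
      (hΦ _ (hreal s t)).comp₂ analyticAt_id analyticAt_const
    have hd' : ∀ s : ℝ, AnalyticAt ℂ (fun z => Φ ((x : ℂ), z)) s := fun s =>
      (hΦ _ (hreal x s)).comp₂ analyticAt_const analyticAt_id
    -- The continuation is real on the real plane, hence so are its derivatives, and the complex
    -- equation restricts to the real one.
    have e0 := deriv_ofReal_eq (hΦphi x) (fun s => (hd' s).differentiableAt) t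
    have e1 := deriv_ofReal_eq (fun s => hΦphi s t) fun s => (hd s).differentiableAt
    have e2 := deriv_ofReal_eq e1 fun s => (hd s).deriv.differentiableAt
    have e3 := deriv_ofReal_eq e2 fun s => (hd s).deriv.deriv.differentiableAt
    have h := ScatteringData.equation_of_tendsto hΦ hlim (hreal x t)
    rw [e0, e1, e3] at h
    rw [iteratedDeriv_succ, iteratedDeriv_succ, iteratedDeriv_one]
    exact_mod_cast h
  · intro ν hν hν' p hp
    have hcos : 0 < Real.cos ν := Real.cos_pos_of_mem_Ioo ⟨by linarith, hν'⟩
    rw [abs_of_nonneg (d.phi_nonneg _ _)]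
    constructor
    · exact le_of_tendsto' (hlim p (d.cyl_mono hν'.le hp)).norm fun N =>
        ScatteringData.norm_mom_le hν hν' hp
    · rw [div_mul_eq_mul_div]
      gcongr
      exact d.phi_le _ _
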